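/- For $\sigma\in L_2(0,\pi)$ complex-valued and $H\in\mathbb C$, let $L(\sigma,H)$ denote the boundary value problem $$-(y^{[1]})'-\sigma(x)y^{[1]}-\sigma^2(x)y=\lambda y\ \text{ a.e. on }(0,\pi),\qquad y^{[1]}(0)=0,\quad y^{[1]}(\pi)+Hy(\pi)=0,$$ where $y^{[1]}:=y'-\sigma y$ and $y,y^{[1]}$ are absolutely continuous on $[0,\pi]$. Let $\varphi(x,\lambda)$ be the solution of the equation with $\varphi(0,\lambda)=1$, $\varphi^{[1]}(0,\lambda)=0$, and let $\Delta(\lambda):=\varphi^{[1]}(\pi,\lambda)+H\varphi(\pi,\lambda)$, an entire function whose zeros are the eigenvalues of $L(\sigma,H)$. Let $\{\lambda_n\}_{n\ge0}$ be the eigenvalues, counted with their multiplicities as zeros of $\Delta$ and numbered so that $|\lambda_n|\le|\lambda_{n+1}|$; assume that they are simple, i.e. $\lambda_n\ne\lambda_k$ for $n\ne k$. Define the weight numbers $\alpha_n:=\left(\int_0^\pi\varphi^2(x,\lambda_n)\,dx\right)^{-1}$, $n\ge0$. Theorem (uniqueness). Let $\sigma,\tilde\sigma\in L_2(0,\pi)$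 be complex-valued and $H,\tilde H\in\mathbb C$, and suppose that all eigenvalues of $L(\sigma,H)$ and of $L(\tilde\sigma,\tilde H)$ are simple. Let $\{\lambda_n,\alpha_n\}_{n\ge0}$ and $\{\tilde\lambda_n,\tilde\alpha_n\}_{n\ge0}$ be the eigenvalues and weight numbers of $L(\sigma,H)$ and $L(\tilde\sigma,\tilde H)$, respectively. If $\lambda_n=\tilde\lambda_n$ and $\alpha_n=\tilde\alpha_n$ for all $n\ge0$, then $\sigma=\tilde\sigma$ in $L_2(0,\pi)$ (that is, almost everywhere on $(0,\pi)$) and $H=\tilde H$. -/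

import Mathlib

open MeasureTheory

namespace SturmLiouville

/-- Lebesgue measure on the interval `(0, π)`. -/
noncomputable def intervalMeasure : Measure ℝ :=
  volume.restrict (Set.Ioo 0 Real.pi)

/-- `y` is a solution on `(0, π)` of `-(y^[1])' - σ y^[1] - σ² y = μ y`, where `z = y^[1] = y' - σ y`
is the quasi-derivative of `y`: both `y` and `y^[1]` are absolutely continuous on `[0, π]`, and
the two equations hold almost everywhere. -/
structure IsSolution (σ : ℝ → ℂ) (μ : ℂ) (y z : ℝ → ℂ) : Prop where
  absCont : AbsolutelyContinuousOnInterval y 0 Real.pi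
  absCont_quasi : AbsolutelyContinuousOnInterval z 0 Real.pi
  quasi_eq : ∀ᵐ x ∂intervalMeasure, z x = deriv y x - σ x * y x
  eqn : ∀ᵐ x ∂intervalMeasure, -deriv z x - σ x * z x - σ x ^ 2 * y x = μ * y x

/-- The solution `φ(·, μ)` with `φ(0, μ) = 1`, `φ^[1](0, μ) = 0`, together with its quasi-derivative.
For `σ ∈ L₂(0, π)` the system for `(y, y^[1])` is linear with integrable coefficients, so this
initial value problem has a solution, and its values on `[0, π]` are unique. -/
noncomputable def phiPair (σ : ℝ → ℂ) (μ : ℂ) : (ℝ → ℂ) × (ℝ → ℂ) :=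
  Classical.epsilon fun p => IsSolution σ μ p.1 p.2 ∧ p.1 0 = 1 ∧ p.2 0 = 0

/-- `φ(x, μ)`. -/
noncomputable def phi (σ : ℝ → ℂ) (μ : ℂ) (x : ℝ) : ℂ := (phiPair σ μ).1 x

/-- `φ^[1](x, μ)`. -/
noncomputable def phiQuasi (σ : ℝ → ℂ) (μ : ℂ) (x : ℝ) : ℂ := (phiPair σ μ).2 x

/-- The characteristic function `Δ(μ) = φ^[1](π, μ) + H φ(π, μ)` of the problem `L(σ, H)`. -/
noncomputable def characteristicFunction (σ : ℝ → ℂ) (H μ : ℂ) : ℂ :=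
  phiQuasi σ μ Real.pi + H * phi σ μ Real.pi

/-- `μ` is an eigenvalue of `L(σ, H)`: there is a nontrivial solution of the equation with
`y^[1](0) = 0` and `y^[1](π) + H y(π) = 0`. -/
def IsEigenvalue (σ : ℝ → ℂ) (H μ : ℂ) : Prop :=
  ∃ y z : ℝ → ℂ, IsSolution σ μ y z ∧ (∃ x ∈ Set.Icc 0 Real.pi, y x ≠ 0) ∧
    z 0 = 0 ∧ z Real.pi + H * y Real.pi = 0

/-- The sequence `lam` lists all eigenvalues of `L(σ, H)`, in order of nondecreasing modulus, each
repeated according to its multiplicity as a zero of the characteristic function. -/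
structure IsEigenvalueSequence (σ : ℝ → ℂ) (H : ℂ) (lam : ℕ → ℂ) : Prop where
  norm_mono : Monotone fun n => ‖lam n‖
  isEigenvalue : ∀ n, IsEigenvalue σ H (lam n)
  multiplicity : ∀ μ, IsEigenvalue σ H μ →
    {n | lam n = μ}.encard = analyticOrderAt (characteristicFunction σ H) μ

/-- The number `(∫₀^π φ²(x, μ) dx)⁻¹`; at `μ = λₙ` it is the weight number `αₙ`. -/
noncomputable def weightNumber (σ : ℝ → ℂ) (μ : ℂ) : ℂ :=
  (∫ x in (0 : ℝ)..Real.pi, phi σ μ x ^ 2)⁻¹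

end SturmLiouville

/-! ### Absolutely continuous functions as primitives of integrable functions -/

namespace SturmLiouville

/-! The argument is the method of spectral mappings, reduced to the one matrix entry that is needed.
Let f be the solution with f(π) = 1, f^[1](π) = -H, so that φ f^[1] - f φ^[1] = -Δ, and let primes
mark the second problem. For fixed x the function N = f φ' Δ' - φ f' Δ is entire in μ. At a common
eigenvalue Δ and Δ' have simple zeros, f = φ / φ(π), and the μ-derivative of Δ times φ(π) equals -∫
φ² (`deriv_characteristicFunction_mul`). Equal weight numbers therefore make N vanish to second
order there, and N / (Δ Δ') is entire. With μ = ρ² and Im ρ ≥ 0, the bounds |φ| ≤ C exp(x Im ρ), |f|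
≤ C exp((π - x) Im ρ) and |ρ| exp(π Im ρ) ≤ 8 |Δ| make this quotient O(1/|ρ|) on the boundaries of
large squares, so it is zero by the maximum principle (`right_mul_phi_mul_eq`).

Hence (f/Δ) φ' = (f'/Δ') φ. Differentiating in x and inserting both Wronskians eliminates σ and σ'
and leaves φ² = φ'² (`sq_eq_sq_of_wronskian`). From here a single μ = -t² with t large is enough: φ
and φ' have no zeros, both equal 1 at 0, so φ = φ' (`phi_eq_phi`). Then (σ - σ') φ is the difference
of the quasi-derivatives; it solves a homogeneous linear first order equation with zero initial
value and vanishes (`ae_eq_of_phi_eq`). Finally H is read off from Δ(λ₀) = 0.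

Since σ is only square integrable, all analysis is done on the system for (y, y^[1]), whose
coefficients are integrable. Inverting a Volterra operator gives existence, uniqueness and entire
dependence on μ; the variables exp(iρx)(y ± i y^[1]/ρ) and a uniform Riemann–Lebesgue lemma give the
asymptotics (`exists_asymptotics`). -/

theorem _root_.AbsolutelyContinuousOnInterval.of_dist_le {X Y : Type*} [PseudoMetricSpace X]
    [PseudoMetricSpace Y] {f : ℝ → X} {g : ℝ → Y} {a b C : ℝ}
    (hg : AbsolutelyContinuousOnInterval g a b)
    (h : ∀ x ∈ Set.uIcc a b, ∀ y ∈ Set.uIcc a b, dist (f x) (f y) ≤ C * dist (g x) (g y)) :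
    AbsolutelyContinuousOnInterval f a b := by
  unfold AbsolutelyContinuousOnInterval at hg ⊢
  refine squeeze_zero' (Filter.Eventually.of_forall fun E => Finset.sum_nonneg fun i _ => dist_nonneg)
    (?_ : ∀ᶠ E in _, _ ≤ C * ∑ i ∈ Finset.range E.1, dist (g (E.2 i).1) (g (E.2 i).2))
    (by simpa using hg.const_mul C)
  filter_upwards [Filter.mem_inf_of_right (Filter.mem_principal_self _)] with E hE
  rw [Finset.mul_sum]
  refine Finset.sum_le_sum fun i hi => ?_
  have := hE.1 i hi
  exact h _ this.1 _ this.2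

/-- `f` is, on `[a, b]`, a primitive of the integrable function `f'`. -/
structure IsPrimitiveOn (f f' : ℝ → ℂ) (a b : ℝ) : Prop where
  integrable : IntervalIntegrable f' volume a b
  eq : ∀ x ∈ Set.Icc a b, f x = f a + ∫ t in a..x, f' t

theorem absolutelyContinuous_integral {E : Type*} [NormedAddCommGroup E] [NormedSpace ℝ E]
    {f : ℝ → E} {a b : ℝ} (hf : IntervalIntegrable f volume a b) :
    AbsolutelyContinuousOnInterval (fun x => ∫ t in a..x, f t) a b := by
  refine (hf.norm.absolutelyContinuousOnInterval_intervalIntegral (c := a) (by simp)).of_dist_le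
    (C := 1) fun x hx y hy => ?_
  have hax : IntervalIntegrable f volume a x := hf.mono_set (Set.uIcc_subset_uIcc (by simp) hx)
  have hay : IntervalIntegrable f volume a y := hf.mono_set (Set.uIcc_subset_uIcc (by simp) hy)
  rw [dist_eq_norm, dist_eq_norm, intervalIntegral.integral_interval_sub_left hax hay,
    intervalIntegral.integral_interval_sub_left hax.norm hay.norm, one_mul, Real.norm_eq_abs]
  exact intervalIntegral.norm_integral_le_abs_integral_norm

namespace IsPrimitiveOn

variable {f f' g g' : ℝ → ℂ} {a b : ℝ}

theorem absCont (hab : a ≤ b) (hf : IsPrimitiveOn f f' a b) :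
    AbsolutelyContinuousOnInterval f a b := by
  refine (absolutelyContinuous_integral hf.integrable).of_dist_le (C := 1) fun x hx y hy => ?_
  rw [Set.uIcc_of_le hab] at hx hy
  rw [hf.eq x hx, hf.eq y hy, one_mul, dist_add_left]

theorem continuousOn (hab : a ≤ b) (hf : IsPrimitiveOn f f' a b) :
    ContinuousOn f (Set.Icc a b) := by
  simpa [Set.uIcc_of_le hab] using (hf.absCont hab).continuousOn

theorem ae_hasDerivAt (hf : IsPrimitiveOn f f' a b) :
    ∀ᵐ x, x ∈ Set.Ioo a b → HasDerivAt f (f' x) x := by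
  filter_upwards [hf.integrable.ae_hasDerivAt_integral] with x hx hxab
  have h1 : HasDerivAt (fun u => f a + ∫ t in a..u, f' t) (f' x) x := by
    simpa using (hx (Set.Icc_subset_uIcc (Set.Ioo_subset_Icc_self hxab)) a (by simp)).const_add (f a)
  refine h1.congr_of_eventuallyEq ?_
  filter_upwards [Ioo_mem_nhds hxab.1 hxab.2] with u hu
  exact hf.eq u (Set.Ioo_subset_Icc_self hu)

theorem of_hasDerivAt (hab : a ≤ b) (hf : AbsolutelyContinuousOnInterval f a b)
    (hi : IntervalIntegrable f' volume a b)
    (hd : ∀ᵐ x, x ∈ Set.Ioo a b → HasDerivAt f (f' x) x) : IsPrimitiveOn f f' a b := by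
  refine ⟨hi, ?_⟩
  have hg := hf.fun_sub (absolutelyContinuous_integral hi)
  obtain ⟨C, hC⟩ := hg.const_of_ae_hasDerivAt_zero <| by
    have h1 : ∀ᵐ x : ℝ, x ≠ a ∧ x ≠ b := by
      have : ({a, b} : Set ℝ).Finite := Set.toFinite _
      filter_upwards [(this.countable.ae_notMem volume)] with x hx
      simpa using hx
    filter_upwards [hd, hi.ae_hasDerivAt_integral, h1] with x h2 h3 h4 hx
    have hx' := hx
    rw [Set.uIcc_of_le hab] at hx'
    have h5 := (h2 ⟨lt_of_le_of_ne hx'.1 (Ne.symm h4.1), lt_of_le_of_ne hx'.2 h4.2⟩).sub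
      (h3 hx a (by simp))
    rw [sub_self] at h5
    exact h5
  intro x hx
  have e1 := hC a (by simp)
  have e2 := hC x (by rwa [Set.uIcc_of_le hab])
  simp only [intervalIntegral.integral_same, sub_zero] at e1
  rw [e1, ← e2]; ring

/-- Passes from equations stated with `deriv` to integral equations. Integrability of the derivative
is obtained from the real and imaginary parts separately. -/
theorem of_absCont (hab : a ≤ b) (hf : AbsolutelyContinuousOnInterval f a b)
    (hd : ∀ᵐ x ∂volume.restrict (Set.Ioo a b), deriv f x = f' x) : IsPrimitiveOn f f' a b := by
  have hre : AbsolutelyContinuousOnInterval (fun x => (f x).re) a b :=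
    hf.of_dist_le (C := 1) fun x _ y _ => by
      rw [one_mul, Real.dist_eq, Complex.dist_eq, ← Complex.sub_re]
      exact Complex.abs_re_le_norm _
  have him : AbsolutelyContinuousOnInterval (fun x => (f x).im) a b :=
    hf.of_dist_le (C := 1) fun x _ y _ => by
      rw [one_mul, Real.dist_eq, Complex.dist_eq, ← Complex.sub_im]
      exact Complex.abs_im_le_norm _
  -- Absolute continuity gives differentiability almost everywhere, so the default value 0 of
  -- `deriv` elsewhere is harmless.
  have hdiff := hf.boundedVariationOn.ae_differentiableAt_of_mem_uIcc
  have hd' : ∀ᵐ x, x ∈ Set.Ioo a b → deriv f x = f' x :=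
    (ae_restrict_iff' measurableSet_Ioo).1 hd
  have hder : ∀ᵐ x, x ∈ Set.Ioo a b → HasDerivAt f (f' x) x := by
    filter_upwards [hdiff, hd'] with x h1 h2 hx
    rw [← h2 hx]
    exact (h1 (Set.Icc_subset_uIcc (Set.Ioo_subset_Icc_self hx))).hasDerivAt
  refine of_hasDerivAt hab hf ?_ hder
  have hofReal : ∀ {g : ℝ → ℝ}, IntervalIntegrable g volume a b →
      IntervalIntegrable (fun x => (g x : ℂ)) volume a b := fun h => ⟨h.1.ofReal, h.2.ofReal⟩
  have hint : IntervalIntegrable (fun x => ((deriv (fun x => (f x).re) x : ℝ) : ℂ) +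
      ((deriv (fun x => (f x).im) x : ℝ) : ℂ) * Complex.I) volume a b :=
    (hofReal hre.intervalIntegrable_deriv).add ((hofReal him.intervalIntegrable_deriv).mul_const _)
  refine hint.congr_ae ?_
  rw [Set.uIoc_of_le hab, ← Measure.restrict_congr_set Ioo_ae_eq_Ioc]
  refine (ae_restrict_iff' measurableSet_Ioo).2 ?_
  filter_upwards [hder] with x hx hxab
  have h := hx hxab
  have h1 : HasDerivAt (fun x => (f x).re) (f' x).re x :=
    (Complex.reCLM.hasFDerivAt.comp_hasDerivAt x h)
  have h2 : HasDerivAt (fun x => (f x).im) (f' x).im x :=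
    (Complex.imCLM.hasFDerivAt.comp_hasDerivAt x h)
  rw [h1.deriv, h2.deriv, Complex.re_add_im]

theorem mono_right {c : ℝ} (hac : a ≤ c) (hcb : c ≤ b) (hf : IsPrimitiveOn f f' a b) :
    IsPrimitiveOn f f' a c :=
  ⟨hf.integrable.mono_set (by
      rw [Set.uIcc_of_le hac, Set.uIcc_of_le (hac.trans hcb)]; exact Set.Icc_subset_Icc_right hcb),
    fun x hx => hf.eq x ⟨hx.1, hx.2.trans hcb⟩⟩

theorem mul (hab : a ≤ b) (hf : IsPrimitiveOn f f' a b) (hg : IsPrimitiveOn g g' a b) :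
    IsPrimitiveOn (fun x => f x * g x) (fun x => f' x * g x + f x * g' x) a b := by
  have hfc := (hf.absCont hab).continuousOn
  have hgc := (hg.absCont hab).continuousOn
  refine of_hasDerivAt hab ((hf.absCont hab).fun_smul (hg.absCont hab))
    ((hf.integrable.mul_continuousOn hgc).add (hg.integrable.continuousOn_mul hfc)) ?_
  filter_upwards [hf.ae_hasDerivAt, hg.ae_hasDerivAt] with x h1 h2 hx
  exact (h1 hx).mul (h2 hx)

theorem add (hab : a ≤ b) (hf : IsPrimitiveOn f f' a b) (hg : IsPrimitiveOn g g' a b) :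
    IsPrimitiveOn (fun x => f x + g x) (fun x => f' x + g' x) a b := by
  refine of_hasDerivAt hab ((hf.absCont hab).fun_add (hg.absCont hab))
    (hf.integrable.add hg.integrable) ?_
  filter_upwards [hf.ae_hasDerivAt, hg.ae_hasDerivAt] with x h1 h2 hx
  exact (h1 hx).add (h2 hx)

theorem sub (hab : a ≤ b) (hf : IsPrimitiveOn f f' a b) (hg : IsPrimitiveOn g g' a b) :
    IsPrimitiveOn (fun x => f x - g x) (fun x => f' x - g' x) a b := by
  refine of_hasDerivAt hab ((hf.absCont hab).fun_sub (hg.absCont hab))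
    (hf.integrable.sub hg.integrable) ?_
  filter_upwards [hf.ae_hasDerivAt, hg.ae_hasDerivAt] with x h1 h2 hx
  exact (h1 hx).sub (h2 hx)

theorem const_mul (c : ℂ) (hf : IsPrimitiveOn f f' a b) :
    IsPrimitiveOn (fun x => c * f x) (fun x => c * f' x) a b := by
  refine ⟨hf.integrable.const_mul c, fun x hx => ?_⟩
  rw [intervalIntegral.integral_const_mul, hf.eq x hx]; ring

theorem congr_deriv (hf : IsPrimitiveOn f f' a b)
    (h : ∀ x, f' x = g' x) : IsPrimitiveOn f g' a b := by
  have : f' = g' := funext h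
  rwa [← this]

theorem congr_fun (hf : IsPrimitiveOn f f' a b)
    (h : ∀ x, f x = g x) : IsPrimitiveOn g f' a b := by
  have : f = g := funext h
  rwa [← this]

theorem integral_eq_sub (hab : a ≤ b) (hf : IsPrimitiveOn f f' a b) :
    ∫ t in a..b, f' t = f b - f a := by
  rw [hf.eq b ⟨hab, le_rfl⟩]; ring

theorem of_contDiff {f : ℝ → ℂ} (hf : ContDiff ℝ 1 f) (a b : ℝ) :
    IsPrimitiveOn f (deriv f) a b := by
  have hc := hf.continuous_deriv le_rfl
  refine ⟨hc.intervalIntegrable _ _, fun x _ => ?_⟩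
  rw [intervalIntegral.integral_deriv_eq_sub (fun x _ => (hf.differentiable (by simp)) x)
    (hc.intervalIntegrable _ _)]
  ring

theorem exp_mul (c : ℂ) (a b : ℝ) :
    IsPrimitiveOn (fun x : ℝ => Complex.exp (c * x)) (fun x => c * Complex.exp (c * x)) a b := by
  have hd : ∀ x : ℝ, HasDerivAt (fun x : ℝ => Complex.exp (c * x)) (c * Complex.exp (c * x)) x := by
    intro x
    have := ((Complex.ofRealCLM.hasDerivAt (x := x)).const_mul c).cexp
    simpa [mul_comm] using this
  have h := of_contDiff (f := fun x : ℝ => Complex.exp (c * x)) (by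
    have : ContDiff ℝ 1 (fun x : ℝ => (x : ℂ)) := Complex.ofRealCLM.contDiff
    fun_prop) a b
  exact h.congr_deriv fun x => (hd x).deriv

theorem of_integrable (hi : IntervalIntegrable f volume a b) :
    IsPrimitiveOn (fun x => ∫ t in a..x, f t) f a b :=
  ⟨hi, fun x _ => by simp⟩

end IsPrimitiveOn

/-! ### A Gronwall inequality with integrable kernel -/

theorem integral_mul_exp_le {k : ℝ → ℝ} {b K : ℝ} (hk : IntervalIntegrable k volume 0 b)
    (hb : 0 ≤ b) (hK : 0 < K) {x : ℝ} (hx : x ∈ Set.Icc 0 b) :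
    ∫ t in (0 : ℝ)..x, k t * Real.exp (K * ∫ s in (0 : ℝ)..t, k s) ≤
      Real.exp (K * ∫ s in (0 : ℝ)..x, k s) / K := by
  have hkx : IntervalIntegrable k volume 0 x := hk.mono_set (by
    rw [Set.uIcc_of_le hx.1, Set.uIcc_of_le hb]; exact Set.Icc_subset_Icc_right hx.2)
  set G : ℝ → ℝ := fun t => ∫ s in (0 : ℝ)..t, k s
  have hG : AbsolutelyContinuousOnInterval G 0 x := absolutelyContinuous_integral hkx
  obtain ⟨C, hC⟩ := hG.exists_bound
  have hE : AbsolutelyContinuousOnInterval (fun t => Real.exp (K * G t)) 0 x := by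
    -- G is bounded and `exp` is Lipschitz on bounded intervals, so exp(K G) is absolutely
    -- continuous and the integral of its derivative can be evaluated.
    obtain ⟨D, hD⟩ := ((Real.contDiff_exp (n := 1)).contDiffOn
      (s := Set.Icc (-(K * C)) (K * C))).exists_lipschitzOnWith (by decide) (convex_Icc _ _)
      isCompact_Icc
    refine (hG.const_mul K).of_dist_le (C := D) fun u hu v hv => hD.dist_le_mul _ ?_ _ ?_
    · have := hC u hu
      rw [Real.norm_eq_abs, abs_le] at this
      constructor <;> nlinarith
    · have := hC v hv
      rw [Real.norm_eq_abs, abs_le] at this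
      constructor <;> nlinarith
  have h := hE.integral_deriv_eq_sub
  have hcongr : ∫ t in (0 : ℝ)..x, deriv (fun t => Real.exp (K * G t)) t =
      ∫ t in (0 : ℝ)..x, K * (k t * Real.exp (K * G t)) := by
    refine intervalIntegral.integral_congr_ae ?_
    filter_upwards [hkx.ae_hasDerivAt_integral] with t ht htx
    have h1 := ht (Set.uIoc_subset_uIcc htx) 0 (by simp)
    have h2 : HasDerivAt (fun t => Real.exp (K * G t)) (Real.exp (K * G t) * (K * k t)) t :=
      (h1.const_mul K).exp
    rw [h2.deriv]; ring
  rw [hcongr, intervalIntegral.integral_const_mul] at h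
  rw [le_div_iff₀ hK, mul_comm, h]
  have : 0 < Real.exp (K * G 0) := Real.exp_pos _
  linarith

/-- Maximise f exp(-2 G) with G = ∫ k over the compact interval. The weight 2 makes the integral
term at most half of the left side at a maximum point, so it can be absorbed. The price is the
non-sharp factors 2, which do not matter here. -/
theorem gronwall {k f : ℝ → ℝ} {a b : ℝ} (hb : 0 ≤ b) (hk : IntervalIntegrable k volume 0 b)
    (hk0 : ∀ t, 0 ≤ k t) (hf : ContinuousOn f (Set.Icc 0 b)) (ha : 0 ≤ a)
    (h : ∀ x ∈ Set.Icc 0 b, f x ≤ a + ∫ t in (0 : ℝ)..x, k t * f t) :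
    ∀ x ∈ Set.Icc 0 b, f x ≤ 2 * a * Real.exp (2 * ∫ t in (0 : ℝ)..x, k t) := by
  set G : ℝ → ℝ := fun t => ∫ s in (0 : ℝ)..t, k s with hGdef
  have hGc : ContinuousOn G (Set.Icc 0 b) := by
    simpa [Set.uIcc_of_le hb] using (absolutelyContinuous_integral hk).continuousOn
  have hwc : ContinuousOn (fun x => f x * Real.exp (-(2 * G x))) (Set.Icc 0 b) := by fun_prop
  have hG0 : ∀ x ∈ Set.Icc 0 b, 0 ≤ G x := fun x hx =>
    intervalIntegral.integral_nonneg hx.1 fun t _ => hk0 t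
  obtain ⟨x₀, hx₀, hmax⟩ := isCompact_Icc.exists_isMaxOn ⟨0, by simp [hb]⟩ hwc
  set M := f x₀ * Real.exp (-(2 * G x₀)) with hM
  have hle : ∀ x ∈ Set.Icc 0 b, f x ≤ M * Real.exp (2 * G x) := fun x hx => by
    have h1 : f x * Real.exp (-(2 * G x)) ≤ M := hmax hx
    have h2 := mul_le_mul_of_nonneg_right h1 (Real.exp_pos (2 * G x)).le
    rwa [mul_assoc, ← Real.exp_add, neg_add_cancel, Real.exp_zero, mul_one] at h2
  have hMa : M ≤ 2 * a := by
    rcases le_or_gt M 0 with hM0 | hM0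
    · linarith
    have hkx : IntervalIntegrable k volume 0 x₀ := hk.mono_set (by
      rw [Set.uIcc_of_le hx₀.1, Set.uIcc_of_le hb]; exact Set.Icc_subset_Icc_right hx₀.2)
    have hsub : Set.uIcc 0 x₀ ⊆ Set.Icc 0 b := by
      rw [Set.uIcc_of_le hx₀.1]; exact Set.Icc_subset_Icc_right hx₀.2
    have h1 : ∫ t in (0 : ℝ)..x₀, k t * f t ≤ ∫ t in (0 : ℝ)..x₀, M * (k t * Real.exp (2 * G t)) := by
      refine intervalIntegral.integral_mono_on hx₀.1 (hkx.mul_continuousOn (hf.mono hsub))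
        ((hkx.mul_continuousOn ?_).const_mul M) fun t ht => ?_
      · have := hGc.mono hsub
        fun_prop
      · have := mul_le_mul_of_nonneg_left (hle t ⟨ht.1, ht.2.trans hx₀.2⟩) (hk0 t)
        linarith
    rw [intervalIntegral.integral_const_mul] at h1
    have h2 := mul_le_mul_of_nonneg_left (integral_mul_exp_le hk hb two_pos hx₀) hM0.le
    have h3 := h x₀ hx₀
    have h4 : M * Real.exp (2 * G x₀) = f x₀ := by
      rw [hM, mul_assoc, ← Real.exp_add, neg_add_cancel, Real.exp_zero, mul_one]
    have h5 : M * Real.exp (2 * G x₀) ≤ a + M * (Real.exp (2 * G x₀) / 2) := by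
      rw [h4]; linarith
    have h6 : 1 ≤ Real.exp (2 * G x₀) := Real.one_le_exp (by linarith [hG0 x₀ hx₀])
    nlinarith
  intro x hx
  exact (hle x hx).trans (mul_le_mul_of_nonneg_right hMa (Real.exp_pos _).le)

/-! ### Volterra operators on continuous functions -/

section Volterra

variable {E : Type*} [NormedAddCommGroup E] [NormedSpace ℂ E]

theorem intervalIntegrable_clm_apply {A : ℝ → E →L[ℂ] E} {f : ℝ → E} {a b : ℝ}
    (hA : IntervalIntegrable A volume a b) (hf : Continuous f) :
    IntervalIntegrable (fun t => A t (f t)) volume a b := by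
  obtain ⟨C, hC⟩ := (isCompact_uIcc (a := a) (b := b)).exists_bound_of_continuousOn hf.continuousOn
  refine (hA.norm.mul_const C).mono_fun ?_ ?_
  · have h1 := hA.def'.aestronglyMeasurable
    have h2 : AEStronglyMeasurable f (volume.restrict (Set.uIoc a b)) :=
      hf.aestronglyMeasurable
    exact (ContinuousLinearMap.apply ℂ E).flip.aestronglyMeasurable_comp₂ h1 h2
  · refine (ae_restrict_iff' measurableSet_uIoc).2 (Filter.Eventually.of_forall fun t ht => ?_)
    have h1 := hC t (Set.uIoc_subset_uIcc ht)
    have h0 : 0 ≤ C := (norm_nonneg _).trans h1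
    simp only [norm_mul, norm_norm, Real.norm_of_nonneg h0]
    exact (A t).le_opNorm_of_le h1

/-- The Volterra operator `Y ↦ ∫₀ˣ A(t) Y(t) dt` on continuous functions on `[0, b]`. -/
noncomputable def volterra {b : ℝ} (hb : 0 ≤ b) (A : ℝ → E →L[ℂ] E)
    (hA : IntervalIntegrable A volume 0 b) :
    C(Set.Icc 0 b, E) →L[ℂ] C(Set.Icc 0 b, E) :=
  LinearMap.mkContinuous
    { toFun := fun Y =>
        ⟨fun x => ∫ t in (0 : ℝ)..x, A t (Set.IccExtend hb Y t), by
          have h := (absolutelyContinuous_integral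
            (intervalIntegrable_clm_apply hA (Y.continuous.Icc_extend' (h := hb)))).continuousOn
          rw [Set.uIcc_of_le hb] at h
          exact h.domRestrict⟩
      map_add' := fun Y Z => by
        ext x
        have hAx : IntervalIntegrable A volume 0 x := hA.mono_set (by
          rw [Set.uIcc_of_le x.2.1, Set.uIcc_of_le hb]; exact Set.Icc_subset_Icc_right x.2.2)
        change ∫ t in (0 : ℝ)..x, A t (Set.IccExtend hb (Y + Z) t) =
          (∫ t in (0 : ℝ)..x, A t (Set.IccExtend hb Y t)) +
            ∫ t in (0 : ℝ)..x, A t (Set.IccExtend hb Z t)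
        rw [← intervalIntegral.integral_add
          (intervalIntegrable_clm_apply hAx Y.continuous.Icc_extend')
          (intervalIntegrable_clm_apply hAx Z.continuous.Icc_extend')]
        simp [Set.IccExtend]
      map_smul' := fun c Y => by
        ext x
        simp [Set.IccExtend, intervalIntegral.integral_smul] }
    (∫ t in (0 : ℝ)..b, ‖A t‖) fun Y => by
      rw [ContinuousMap.norm_le _ (mul_nonneg
        (intervalIntegral.integral_nonneg hb fun t _ => norm_nonneg _) (norm_nonneg _))]
      intro x
      have hsub : Set.uIcc (0 : ℝ) x ⊆ Set.uIcc 0 b := by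
        rw [Set.uIcc_of_le x.2.1, Set.uIcc_of_le hb]; exact Set.Icc_subset_Icc_right x.2.2
      calc ‖∫ t in (0 : ℝ)..x, A t (Set.IccExtend hb Y t)‖
          ≤ ∫ t in (0 : ℝ)..x, ‖A t‖ * ‖Y‖ := by
            refine intervalIntegral.norm_integral_le_of_norm_le x.2.1
              (Filter.Eventually.of_forall fun t _ => (A t).le_opNorm_of_le ?_)
              ((hA.mono_set hsub).norm.mul_const _)
            exact Y.norm_coe_le_norm _
        _ = (∫ t in (0 : ℝ)..x, ‖A t‖) * ‖Y‖ := intervalIntegral.integral_mul_const _ _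
        _ ≤ (∫ t in (0 : ℝ)..b, ‖A t‖) * ‖Y‖ := by
            refine mul_le_mul_of_nonneg_right ?_ (norm_nonneg _)
            exact intervalIntegral.integral_mono_interval le_rfl x.2.1 x.2.2
              (Filter.Eventually.of_forall fun t => norm_nonneg _) hA.norm

/-- Multiplication by a scalar function. -/
noncomputable def mulOperator {X : Type*} [TopologicalSpace X] [CompactSpace X] (w : C(X, ℂ)) :
    C(X, E) →L[ℂ] C(X, E) :=
  LinearMap.mkContinuous
    { toFun := fun Y => w • Y
      map_add' := fun Y Z => smul_add _ _ _
      map_smul' := fun c Y => by ext x; simp [smul_smul, mul_comm] }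
    ‖w‖ fun Y => by
      rw [ContinuousMap.norm_le _ (by positivity)]
      intro x
      simp only [LinearMap.coe_mk, AddHom.coe_mk, ContinuousMap.smul_apply', norm_smul]
      exact mul_le_mul (w.norm_coe_le_norm x) (Y.norm_coe_le_norm x) (norm_nonneg _) (norm_nonneg _)

theorem mulOperator_apply {X : Type*} [TopologicalSpace X] [CompactSpace X] (w : C(X, ℂ))
    (Y : C(X, E)) (x : X) : mulOperator w Y x = w x • Y x := rfl

/-- Conjugation by multiplication with exp(-2 ∫₀ˣ ‖A‖) brings the operator norm down to at most 1/2,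
because ∫ ‖A‖ exp(2 G) ≤ exp(2 G)/2. The Neumann series then applies with no smallness assumption on
A. -/
theorem isUnit_one_sub_volterra [CompleteSpace E] {b : ℝ} (hb : 0 ≤ b) {A : ℝ → E →L[ℂ] E}
    (hA : IntervalIntegrable A volume 0 b) : IsUnit (1 - volterra hb A hA) := by
  set G : ℝ → ℝ := fun t => ∫ s in (0 : ℝ)..t, ‖A s‖ with hGdef
  have hGc : ContinuousOn G (Set.Icc 0 b) := by
    simpa [Set.uIcc_of_le hb] using (absolutelyContinuous_integral hA.norm).continuousOn
  have hGr : Continuous fun x : Set.Icc 0 b => G x := hGc.domRestrict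
  let w : C(Set.Icc 0 b, ℂ) := ⟨fun x => ((Real.exp (-(2 * G x)) : ℝ) : ℂ),
    Complex.continuous_ofReal.comp (Real.continuous_exp.comp (hGr.const_mul 2).neg)⟩
  let w' : C(Set.Icc 0 b, ℂ) := ⟨fun x => ((Real.exp (2 * G x) : ℝ) : ℂ),
    Complex.continuous_ofReal.comp (Real.continuous_exp.comp (hGr.const_mul 2))⟩
  have hww : ∀ x, w x * w' x = 1 := fun x => by
    simp only [w, w', ContinuousMap.coe_mk]
    rw [← Complex.ofReal_mul, ← Real.exp_add, neg_add_cancel, Real.exp_zero, Complex.ofReal_one]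
  have hM1 : (mulOperator w : C(Set.Icc 0 b, E) →L[ℂ] _) * mulOperator w' = 1 := by
    ext Y x
    simp [mulOperator_apply, smul_smul, hww]
  have hM2 : (mulOperator w' : C(Set.Icc 0 b, E) →L[ℂ] _) * mulOperator w = 1 := by
    ext Y x
    simp [mulOperator_apply, smul_smul, hww, mul_comm (w' x)]
  let W : (C(Set.Icc 0 b, E) →L[ℂ] C(Set.Icc 0 b, E))ˣ := ⟨mulOperator w, mulOperator w', hM1, hM2⟩
  have hnorm : ‖mulOperator w * volterra hb A hA * mulOperator w'‖ < 1 := by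
    refine lt_of_le_of_lt (ContinuousLinearMap.opNorm_le_bound _ (by norm_num : (0 : ℝ) ≤ 1 / 2)
      fun Y => ?_) (by norm_num)
    rw [ContinuousMap.norm_le _ (by positivity)]
    intro x
    have hsub : Set.uIcc (0 : ℝ) x ⊆ Set.uIcc 0 b := by
      rw [Set.uIcc_of_le x.2.1, Set.uIcc_of_le hb]; exact Set.Icc_subset_Icc_right x.2.2
    have hsub' : Set.uIcc (0 : ℝ) x ⊆ Set.Icc 0 b := hsub.trans (Set.uIcc_of_le hb).subset
    change ‖w x • ∫ t in (0 : ℝ)..x, A t (Set.IccExtend hb (mulOperator w' Y) t)‖ ≤ _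
    have h1 : ‖∫ t in (0 : ℝ)..x, A t (Set.IccExtend hb (mulOperator w' Y) t)‖ ≤
        ∫ t in (0 : ℝ)..x, ‖A t‖ * Real.exp (2 * G t) * ‖Y‖ := by
      refine intervalIntegral.norm_integral_le_of_norm_le x.2.1
        (Filter.Eventually.of_forall fun t ht => ?_) ?_
      · rw [mul_assoc]
        refine (A t).le_opNorm_of_le ?_
        have htm : t ∈ Set.Icc 0 b := ⟨ht.1.le, ht.2.trans x.2.2⟩
        rw [Set.IccExtend_of_mem hb _ htm, mulOperator_apply, norm_smul]
        refine mul_le_mul (le_of_eq ?_) (Y.norm_coe_le_norm _) (norm_nonneg _) (Real.exp_pos _).le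
        simp only [w', ContinuousMap.coe_mk, Complex.norm_real, Real.norm_eq_abs, Real.abs_exp]
      · refine ((hA.mono_set hsub).norm.mul_continuousOn ?_).mul_const _
        have := hGc.mono hsub'
        fun_prop
    rw [intervalIntegral.integral_mul_const] at h1
    have h2 := integral_mul_exp_le hA.norm hb two_pos x.2
    have h3 : ‖w x‖ = Real.exp (-(2 * G x)) := by
      simp only [w, ContinuousMap.coe_mk, Complex.norm_real, Real.norm_eq_abs, Real.abs_exp]
    rw [norm_smul, h3]
    calc _ ≤ Real.exp (-(2 * G x)) * (Real.exp (2 * G x) / 2 * ‖Y‖) :=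
          mul_le_mul_of_nonneg_left (h1.trans (mul_le_mul_of_nonneg_right h2 (norm_nonneg _)))
            (Real.exp_pos _).le
      _ = 1 / 2 * ‖Y‖ := by
          rw [← mul_assoc, mul_div_assoc', ← Real.exp_add, neg_add_cancel, Real.exp_zero]
  have hu := isUnit_one_sub_of_norm_lt_one (R := C(Set.Icc 0 b, E) →L[ℂ] C(Set.Icc 0 b, E)) hnorm
  have hconj : 1 - volterra hb A hA =
      mulOperator w' * (1 - mulOperator w * volterra hb A hA * mulOperator w') * mulOperator w := by
    rw [mul_sub, sub_mul, mul_one, hM2]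
    congr 1
    calc volterra hb A hA = 1 * volterra hb A hA * 1 := by rw [one_mul, mul_one]
      _ = _ := by rw [← hM2]; simp only [mul_assoc]
  rw [hconj]
  exact (W⁻¹.isUnit.mul hu).mul W.isUnit

end Volterra

theorem differentiable_inverse_one_sub_apply {X : Type*} [NormedAddCommGroup X] [NormedSpace ℂ X]
    [CompleteSpace X] (S B : X →L[ℂ] X) (h : ∀ μ : ℂ, IsUnit (1 - (S + μ • B))) (c : X) :
    Differentiable ℂ fun μ : ℂ => Ring.inverse (1 - (S + μ • B)) c := by
  intro μ
  have h1 : DifferentiableAt ℂ (fun μ : ℂ => 1 - (S + μ • B)) μ := by fun_prop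
  have h2 : DifferentiableAt ℂ (fun μ : ℂ => Ring.inverse (1 - (S + μ • B))) μ :=
    DifferentiableAt.comp (g := Ring.inverse) μ (differentiableAt_inverse (𝕜 := ℂ) (h μ)) h1
  exact h2.clm_apply (differentiableAt_const _)

/-! ### Existence, uniqueness and analyticity of solutions -/

section Existence

variable {σ : ℝ → ℂ}

theorem intervalIntegrable_of_memLp (hσ : MemLp σ 2 intervalMeasure) :
    IntervalIntegrable σ volume 0 Real.pi := by
  rw [intervalIntegrable_iff_integrableOn_Ioo_of_le Real.pi_pos.le]
  have : IsFiniteMeasure intervalMeasure := by unfold intervalMeasure; infer_instance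
  exact hσ.integrable one_le_two

theorem intervalIntegrable_sq_of_memLp (hσ : MemLp σ 2 intervalMeasure) :
    IntervalIntegrable (fun t => σ t ^ 2) volume 0 Real.pi := by
  rw [intervalIntegrable_iff_integrableOn_Ioo_of_le Real.pi_pos.le]
  have h : Integrable (fun t => σ t * σ t) intervalMeasure := hσ.integrable_mul hσ
  simpa only [IntegrableOn, pow_two, intervalMeasure] using h

namespace IsSolution

variable {μ : ℂ} {y z : ℝ → ℂ}

theorem isPrimitiveOn (h : IsSolution σ μ y z) :
    IsPrimitiveOn y (fun x => σ x * y x + z x) 0 Real.pi := by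
  refine IsPrimitiveOn.of_absCont Real.pi_pos.le h.absCont ?_
  filter_upwards [h.quasi_eq] with x hx
  rw [hx]; ring

theorem isPrimitiveOn_quasi (h : IsSolution σ μ y z) :
    IsPrimitiveOn z (fun x => -(σ x * z x) - σ x ^ 2 * y x - μ * y x) 0 Real.pi := by
  refine IsPrimitiveOn.of_absCont Real.pi_pos.le h.absCont_quasi ?_
  filter_upwards [h.eqn] with x hx
  rw [← hx]; ring

theorem of_isPrimitiveOn (hy : IsPrimitiveOn y (fun x => σ x * y x + z x) 0 Real.pi)
    (hz : IsPrimitiveOn z (fun x => -(σ x * z x) - σ x ^ 2 * y x - μ * y x) 0 Real.pi) :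
    IsSolution σ μ y z where
  absCont := hy.absCont Real.pi_pos.le
  absCont_quasi := hz.absCont Real.pi_pos.le
  quasi_eq := by
    refine (ae_restrict_iff' measurableSet_Ioo).2 ?_
    filter_upwards [hy.ae_hasDerivAt] with x hx hx'
    rw [(hx hx').deriv]; ring
  eqn := by
    refine (ae_restrict_iff' measurableSet_Ioo).2 ?_
    filter_upwards [hz.ae_hasDerivAt] with x hx hx'
    rw [(hx hx').deriv]; ring

end IsSolution

/-- The constant coefficient `(y, z) ↦ (0, -y)` of the spectral parameter in the first order
system. -/
noncomputable def spectralCoeff : ℂ × ℂ →L[ℂ] ℂ × ℂ :=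
  (0 : ℂ × ℂ →L[ℂ] ℂ).prod (-ContinuousLinearMap.fst ℂ ℂ ℂ)

/-- The coefficient `(y, z) ↦ (σ y + z, -σ z - σ² y)` of the first order system. -/
noncomputable def systemCoeff (σ : ℝ → ℂ) (t : ℝ) : ℂ × ℂ →L[ℂ] ℂ × ℂ :=
  σ t • (ContinuousLinearMap.fst ℂ ℂ ℂ).prod (-ContinuousLinearMap.snd ℂ ℂ ℂ) +
    σ t ^ 2 • spectralCoeff + (ContinuousLinearMap.snd ℂ ℂ ℂ).prod 0

theorem intervalIntegrable_systemCoeff (hσ : MemLp σ 2 intervalMeasure) :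
    IntervalIntegrable (systemCoeff σ) volume 0 Real.pi := by
  have h1 := intervalIntegrable_of_memLp hσ
  have h2 := intervalIntegrable_sq_of_memLp hσ
  have hs : ∀ {f : ℝ → ℂ} (L : ℂ × ℂ →L[ℂ] ℂ × ℂ), IntervalIntegrable f volume 0 Real.pi →
      IntervalIntegrable (fun t => f t • L) volume 0 Real.pi :=
    fun L h => ⟨Integrable.smul_const h.1 L, Integrable.smul_const h.2 L⟩
  exact ((hs _ h1).add (hs _ h2)).add intervalIntegrable_const

theorem intervalIntegrable_systemCoeff_add (hσ : MemLp σ 2 intervalMeasure) (μ : ℂ) :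
    IntervalIntegrable (fun t => systemCoeff σ t + μ • spectralCoeff) volume 0 Real.pi :=
  (intervalIntegrable_systemCoeff hσ).add intervalIntegrable_const

theorem systemCoeff_apply (μ : ℂ) (t : ℝ) (p : ℂ × ℂ) :
    (systemCoeff σ t + μ • spectralCoeff) p =
      (σ t * p.1 + p.2, -(σ t * p.2) - σ t ^ 2 * p.1 - μ * p.1) := by
  ext
  · simp [systemCoeff, spectralCoeff]
  · simp [systemCoeff, spectralCoeff]; ring

/-- The integral operator of the system with spectral parameter `μ`. -/
noncomputable def systemOperator (hσ : MemLp σ 2 intervalMeasure) (μ : ℂ) :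
    C(Set.Icc 0 Real.pi, ℂ × ℂ) →L[ℂ] C(Set.Icc 0 Real.pi, ℂ × ℂ) :=
  volterra Real.pi_pos.le _ (intervalIntegrable_systemCoeff_add hσ μ)

/-- Affine dependence on μ is what makes the inverse of 1 - T(μ), and hence the solutions, entire in
μ. -/
theorem systemOperator_eq (hσ : MemLp σ 2 intervalMeasure) (μ : ℂ) :
    systemOperator hσ μ = volterra Real.pi_pos.le _ (intervalIntegrable_systemCoeff hσ) +
      μ • volterra Real.pi_pos.le (fun _ => spectralCoeff) intervalIntegrable_const := by
  refine ContinuousLinearMap.ext fun Y => ContinuousMap.ext fun x => ?_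
  change ∫ t in (0 : ℝ)..x, (systemCoeff σ t + μ • spectralCoeff)
      (Set.IccExtend Real.pi_pos.le Y t) =
    (∫ t in (0 : ℝ)..x, systemCoeff σ t (Set.IccExtend Real.pi_pos.le Y t)) +
      μ • ∫ t in (0 : ℝ)..x, spectralCoeff (Set.IccExtend Real.pi_pos.le Y t)
  have hsub : Set.uIcc (0 : ℝ) x ⊆ Set.uIcc 0 Real.pi := by
    rw [Set.uIcc_of_le x.2.1, Set.uIcc_of_le Real.pi_pos.le]
    exact Set.Icc_subset_Icc_right x.2.2
  rw [← intervalIntegral.integral_smul, ← intervalIntegral.integral_add]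
  · rfl
  · exact intervalIntegrable_clm_apply ((intervalIntegrable_systemCoeff hσ).mono_set hsub)
      Y.continuous.Icc_extend'
  · exact (spectralCoeff.continuous.comp Y.continuous.Icc_extend').const_smul μ
      |>.intervalIntegrable _ _

theorem isUnit_one_sub_systemOperator (hσ : MemLp σ 2 intervalMeasure) (μ : ℂ) :
    IsUnit (1 - systemOperator hσ μ) :=
  isUnit_one_sub_volterra _ _

/-- A solution, as a continuous pair Y, satisfies (1 - T) Y = Y(0) with T the integral operator of
the system, and 1 - T is injective. -/
theorem IsSolution.eqOn {μ : ℂ} {y z y₁ z₁ : ℝ → ℂ} (hσ : MemLp σ 2 intervalMeasure)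
    (h : IsSolution σ μ y z) (h₁ : IsSolution σ μ y₁ z₁) (h0 : y 0 = y₁ 0) (h0' : z 0 = z₁ 0) :
    ∀ x ∈ Set.Icc 0 Real.pi, y x = y₁ x ∧ z x = z₁ x := by
  have key : ∀ {y z : ℝ → ℂ}, IsSolution σ μ y z → ∃ Y : C(Set.Icc 0 Real.pi, ℂ × ℂ),
      (∀ x, Y x = (y x, z x)) ∧
      (1 - systemOperator hσ μ) Y = ContinuousMap.const _ (y 0, z 0) := by
    intro y z h
    have hc1 := h.isPrimitiveOn.continuousOn Real.pi_pos.le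
    have hc2 := h.isPrimitiveOn_quasi.continuousOn Real.pi_pos.le
    let Y : C(Set.Icc 0 Real.pi, ℂ × ℂ) := ⟨fun x => (y x, z x),
      (continuousOn_iff_continuous_domRestrict.1 hc1).prodMk
        (continuousOn_iff_continuous_domRestrict.1 hc2)⟩
    refine ⟨Y, fun _ => rfl, ContinuousMap.ext fun x => ?_⟩
    change (y x, z x) - ∫ t in (0 : ℝ)..x, (systemCoeff σ t + μ • spectralCoeff)
      (Set.IccExtend Real.pi_pos.le Y t) = (y 0, z 0)
    have e : ∫ t in (0 : ℝ)..x, (systemCoeff σ t + μ • spectralCoeff)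
        (Set.IccExtend Real.pi_pos.le Y t) = ∫ t in (0 : ℝ)..x,
        ((σ t * y t + z t, -(σ t * z t) - σ t ^ 2 * y t - μ * y t) : ℂ × ℂ) := by
      refine intervalIntegral.integral_congr fun t ht => ?_
      rw [Set.uIcc_of_le x.2.1] at ht
      rw [Set.IccExtend_of_mem _ _ ⟨ht.1, ht.2.trans x.2.2⟩, systemCoeff_apply]
      rfl
    have hp := h.isPrimitiveOn.mono_right x.2.1 x.2.2
    have hq := h.isPrimitiveOn_quasi.mono_right x.2.1 x.2.2
    have e2 : ∫ t in (0 : ℝ)..x,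
        ((σ t * y t + z t, -(σ t * z t) - σ t ^ 2 * y t - μ * y t) : ℂ × ℂ) =
        (y x - y 0, z x - z 0) := by
      rw [← hp.integral_eq_sub x.2.1, ← hq.integral_eq_sub x.2.1]
      have hi : IntervalIntegrable (fun t =>
        ((σ t * y t + z t, -(σ t * z t) - σ t ^ 2 * y t - μ * y t) : ℂ × ℂ)) volume 0 x :=
        ⟨hp.integrable.1.prodMk hq.integrable.1, hp.integrable.2.prodMk hq.integrable.2⟩
      ext
      · exact ((ContinuousLinearMap.fst ℂ ℂ ℂ).intervalIntegral_comp_comm hi).symm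
      · exact ((ContinuousLinearMap.snd ℂ ℂ ℂ).intervalIntegral_comp_comm hi).symm
    rw [e, e2]
    ext <;> simp
  obtain ⟨Y, hY, hYe⟩ := key h
  obtain ⟨Y₁, hY₁, hYe₁⟩ := key h₁
  rw [← h0, ← h0'] at hYe₁
  obtain ⟨u, hu⟩ := isUnit_one_sub_systemOperator hσ μ
  have hinj : ∀ Z, (↑u⁻¹ : C(Set.Icc 0 Real.pi, ℂ × ℂ) →L[ℂ] _) ((1 - systemOperator hσ μ) Z) =
      Z := fun Z => by
    rw [← hu, ← mul_apply_eq_comp, Units.inv_mul, one_apply_eq_self]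
  have hYY : Y = Y₁ := by rw [← hinj Y, ← hinj Y₁, hYe, hYe₁]
  intro x hx
  have := hY ⟨x, hx⟩
  rw [hYY, hY₁] at this
  simpa [eq_comm] using this

/-- The solutions are the inverse of 1 - T(μ) applied to the constant initial vector. Since this is
analytic with values in the space of continuous functions, evaluation gives joint continuity in (μ,
x) as well. Beyond [0, π] the functions are extended by their endpoint values. -/
theorem exists_isSolution_family (hσ : MemLp σ 2 intervalMeasure) (a c : ℂ) :
    ∃ y z : ℂ → ℝ → ℂ, (∀ μ, IsSolution σ μ (y μ) (z μ) ∧ y μ 0 = a ∧ z μ 0 = c) ∧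
      Continuous (fun p : ℂ × ℝ => y p.1 p.2) ∧
      (∀ x, Differentiable ℂ fun μ => y μ x) ∧ ∀ x, Differentiable ℂ fun μ => z μ x := by
  have hπ := Real.pi_pos.le
  let R : ℂ → C(Set.Icc 0 Real.pi, ℂ × ℂ) := fun μ =>
    Ring.inverse (1 - systemOperator hσ μ) (ContinuousMap.const _ (a, c))
  have hRd : Differentiable ℂ R := by
    have h := differentiable_inverse_one_sub_apply _ _ (fun μ => by
      rw [← systemOperator_eq hσ μ]; exact isUnit_one_sub_systemOperator hσ μ)
      (ContinuousMap.const (Set.Icc 0 Real.pi) (a, c))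
    simpa only [← systemOperator_eq hσ] using h
  have hReq : ∀ μ (x : Set.Icc 0 Real.pi), R μ x = (a, c) + ∫ t in (0 : ℝ)..x,
      (systemCoeff σ t + μ • spectralCoeff) (Set.IccExtend hπ (R μ) t) := by
    intro μ x
    have h : (1 - systemOperator hσ μ) (R μ) = ContinuousMap.const _ (a, c) := by
      simp only [R]
      rw [← mul_apply_eq_comp,
        Ring.mul_inverse_cancel _ (isUnit_one_sub_systemOperator hσ μ),
        one_apply_eq_self]
    have h' : R μ x - ∫ t in (0 : ℝ)..x,
      (systemCoeff σ t + μ • spectralCoeff) (Set.IccExtend hπ (R μ) t) = (a, c) :=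
      congrArg (fun Y : C(Set.Icc 0 Real.pi, ℂ × ℂ) => Y x) h
    rw [← h']; abel
  have hev : ∀ x, Differentiable ℂ fun μ => Set.IccExtend hπ (R μ) x := by
    intro x
    have h : Differentiable ℂ fun μ =>
        ContinuousMap.evalCLM ℂ (Set.projIcc 0 Real.pi hπ x) (R μ) :=
      Differentiable.comp (g := ContinuousMap.evalCLM ℂ (Set.projIcc 0 Real.pi hπ x))
        (ContinuousLinearMap.differentiable _) hRd
    exact h
  refine ⟨fun μ x => (Set.IccExtend hπ (R μ) x).1, fun μ x => (Set.IccExtend hπ (R μ) x).2,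
    fun μ => ?_, ?_, fun x => (hev x).fst, fun x => (hev x).snd⟩
  · have h0 : Set.IccExtend hπ (R μ) 0 = (a, c) := by
      rw [Set.IccExtend_of_mem hπ _ (Set.left_mem_Icc.2 hπ), hReq]
      simp
    have hi : IntervalIntegrable (fun t => (systemCoeff σ t + μ • spectralCoeff)
        (Set.IccExtend hπ (R μ) t)) volume 0 Real.pi :=
      intervalIntegrable_clm_apply (intervalIntegrable_systemCoeff_add hσ μ)
        (R μ).continuous.Icc_extend'
    have hix : ∀ x ∈ Set.Icc 0 Real.pi, IntervalIntegrable (fun t =>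
        (systemCoeff σ t + μ • spectralCoeff) (Set.IccExtend hπ (R μ) t)) volume 0 x :=
      fun x hx => hi.mono_set (by
        rw [Set.uIcc_of_le hx.1, Set.uIcc_of_le hπ]; exact Set.Icc_subset_Icc_right hx.2)
    refine ⟨IsSolution.of_isPrimitiveOn ⟨?_, fun x hx => ?_⟩ ⟨?_, fun x hx => ?_⟩,
      congrArg Prod.fst h0, congrArg Prod.snd h0⟩
    · have h : IntervalIntegrable (fun t => ((systemCoeff σ t + μ • spectralCoeff)
        (Set.IccExtend hπ (R μ) t)).1) volume 0 Real.pi := ⟨hi.1.fst, hi.2.fst⟩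
      simp only [systemCoeff_apply] at h
      exact h
    · have e := (ContinuousLinearMap.fst ℂ ℂ ℂ).intervalIntegral_comp_comm (hix x hx)
      simp only [ContinuousLinearMap.coe_fst', systemCoeff_apply] at e
      beta_reduce
      rw [e, h0, Set.IccExtend_of_mem hπ _ hx, hReq]
      simp only [systemCoeff_apply, Prod.fst_add]
    · have h : IntervalIntegrable (fun t => ((systemCoeff σ t + μ • spectralCoeff)
        (Set.IccExtend hπ (R μ) t)).2) volume 0 Real.pi := ⟨hi.1.snd, hi.2.snd⟩
      simp only [systemCoeff_apply] at h
      exact h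
    · have e := (ContinuousLinearMap.snd ℂ ℂ ℂ).intervalIntegral_comp_comm (hix x hx)
      simp only [ContinuousLinearMap.coe_snd', systemCoeff_apply] at e
      beta_reduce
      rw [e, h0, Set.IccExtend_of_mem hπ _ hx, hReq]
      simp only [systemCoeff_apply, Prod.snd_add]
  · have h1 : Continuous fun p : ℂ × ℝ => R p.1 (Set.projIcc 0 Real.pi hπ p.2) :=
      (ContinuousEval.continuous_eval (F := C(Set.Icc 0 Real.pi, ℂ × ℂ))).comp
        ((hRd.continuous.comp continuous_fst).prodMk ((continuous_projIcc (h := hπ)).comp continuous_snd))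
    exact h1.fst

end Existence

/-! ### Oscillatory integrals with complex frequency -/

theorem norm_intervalIntegral_mul_le {f g : ℝ → ℂ} {s x b D : ℝ} (hs : 0 ≤ s) (hsx : s ≤ x)
    (hxb : x ≤ b) (hf : IntervalIntegrable f volume 0 b)
    (hg : ∀ t ∈ Set.Icc s x, ‖g t‖ ≤ D) :
    ‖∫ t in s..x, f t * g t‖ ≤ D * ∫ t in (0 : ℝ)..b, ‖f t‖ := by
  have hD : 0 ≤ D := (norm_nonneg _).trans (hg s ⟨le_rfl, hsx⟩)
  have hfs : IntervalIntegrable f volume s x := hf.mono_set (by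
    rw [Set.uIcc_of_le hsx, Set.uIcc_of_le (hs.trans (hsx.trans hxb))]
    exact Set.Icc_subset_Icc hs hxb)
  have h1 : ‖∫ t in s..x, f t * g t‖ ≤ ∫ t in s..x, D * ‖f t‖ := by
    refine intervalIntegral.norm_integral_le_of_norm_le hsx
      (Filter.Eventually.of_forall fun t ht => ?_) (hfs.norm.const_mul D)
    rw [norm_mul, mul_comm]
    exact mul_le_mul_of_nonneg_right (hg t (Set.Ioc_subset_Icc_self ht)) (norm_nonneg _)
  rw [intervalIntegral.integral_const_mul] at h1
  refine h1.trans (mul_le_mul_of_nonneg_left ?_ hD)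
  exact intervalIntegral.integral_mono_interval hs hsx hxb
    (Filter.Eventually.of_forall fun t => norm_nonneg _) hf.norm

/-- A Riemann–Lebesgue lemma with complex frequency, uniform in the subinterval. -/
theorem riemannLebesgue_uniform {σ : ℝ → ℂ} {b δ : ℝ} (hb : 0 ≤ b)
    (hσ : IntervalIntegrable σ volume 0 b) (hδ : 0 < δ) :
    ∃ R : ℝ, ∀ (c : ℂ) (t₀ s x : ℝ), R ≤ ‖c‖ → 0 ≤ s → s ≤ x → x ≤ b →
      (∀ t ∈ Set.Icc s x, (c * (t - t₀)).re ≤ 0) →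
      ‖∫ t in s..x, σ t * Complex.exp (c * (t - t₀))‖ ≤ δ := by
  have hmem : MemLp σ 1 (volume.restrict (Set.Ioc 0 b)) := memLp_one_iff_integrable.2 hσ.1
  obtain ⟨g, hgs, hgc, hgn⟩ := hmem.exist_eLpNorm_sub_le (by simp) le_rfl (half_pos hδ)
  have hg1 : ContDiff ℝ 1 g := hgc.of_le (by exact_mod_cast le_top)
  have hd : IntervalIntegrable (fun t => σ t - g t) volume 0 b :=
    hσ.sub (hg1.continuous.intervalIntegrable _ _)
  have hdn : ∫ t in (0 : ℝ)..b, ‖σ t - g t‖ ≤ δ / 2 := by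
    rw [intervalIntegral.integral_of_le hb, integral_norm_eq_lintegral_enorm hd.1.aestronglyMeasurable]
    refine ENNReal.toReal_le_of_le_ofReal (half_pos hδ).le ?_
    rw [eLpNorm_one_eq_lintegral_enorm] at hgn
    exact hgn
  obtain ⟨M, hM⟩ := hgs.exists_bound_of_continuous hg1.continuous
  obtain ⟨M', hM'⟩ := isCompact_Icc.exists_bound_of_continuousOn
    (hg1.continuous_deriv le_rfl).continuousOn (s := Set.Icc 0 b)
  have hM0 : 0 ≤ M := (norm_nonneg _).trans (hM 0)
  have hM0' : 0 ≤ M' := (norm_nonneg _).trans (hM' 0 ⟨le_rfl, hb⟩)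
  -- Integration by parts of the smooth approximant g costs 2 M for the boundary terms and b M' for
  -- the integral of its derivative. The added 1 keeps ‖c‖ positive.
  refine ⟨(2 * M + b * M') / (δ / 2) + 1, fun c t₀ s x hc hs hsx hxb hre => ?_⟩
  have hE : ∀ t ∈ Set.Icc s x, ‖Complex.exp (c * (t - t₀))‖ ≤ 1 := fun t ht => by
    rw [Complex.norm_exp]
    exact Real.exp_le_one_iff.2 (hre t ht)
  have hcont : Continuous fun t : ℝ => Complex.exp (c * (t - t₀)) := by fun_prop
  have hc0 : 0 < ‖c‖ := lt_of_lt_of_le (by positivity) hc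
  have hsub : Set.uIcc s x ⊆ Set.uIcc 0 b := by
    rw [Set.uIcc_of_le hsx, Set.uIcc_of_le hb]; exact Set.Icc_subset_Icc hs hxb
  have h1 : ‖∫ t in s..x, (σ t - g t) * Complex.exp (c * (t - t₀))‖ ≤ δ / 2 := by
    have := norm_intervalIntegral_mul_le hs hsx hxb hd hE
    linarith
  have h2 : ‖∫ t in s..x, g t * Complex.exp (c * (t - t₀))‖ ≤ δ / 2 := by
    have hEp : IsPrimitiveOn (fun t : ℝ => Complex.exp (c * (t - t₀)))
        (fun t => c * Complex.exp (c * (t - t₀))) s x := by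
      have := (IsPrimitiveOn.exp_mul c s x).const_mul (Complex.exp (-(c * t₀)))
      have e : ∀ t : ℝ, Complex.exp (-(c * t₀)) * Complex.exp (c * t) =
          Complex.exp (c * (t - t₀)) := fun t => by
        rw [← Complex.exp_add]; ring_nf
      simp only [e] at this
      exact this.congr_deriv fun t => by rw [← e t]; ring
    have hp := ((IsPrimitiveOn.of_contDiff hg1 s x).mul hsx hEp).integral_eq_sub hsx
    have hi1 : IntervalIntegrable (fun t => deriv g t * Complex.exp (c * (t - t₀))) volume s x :=
      ((hg1.continuous_deriv le_rfl).mul hcont).intervalIntegrable _ _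
    have hi2 : IntervalIntegrable (fun t => g t * (c * Complex.exp (c * (t - t₀)))) volume s x :=
      (hg1.continuous.mul (hcont.const_mul c)).intervalIntegrable _ _
    rw [intervalIntegral.integral_add hi1 hi2] at hp
    have e3 : ∫ t in s..x, g t * (c * Complex.exp (c * (t - t₀))) =
        c * ∫ t in s..x, g t * Complex.exp (c * (t - t₀)) := by
      rw [← intervalIntegral.integral_const_mul]
      congr 1; funext t; ring
    rw [e3] at hp
    have h4 : ‖∫ t in s..x, deriv g t * Complex.exp (c * (t - t₀))‖ ≤ M' * b := by
      refine (intervalIntegral.norm_integral_le_of_norm_le_const (C := M') fun t ht => ?_).trans ?_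
      · rw [Set.uIoc_of_le hsx] at ht
        have ht' := Set.Ioc_subset_Icc_self ht
        rw [norm_mul]
        calc _ ≤ M' * 1 := mul_le_mul (hM' t ⟨hs.trans ht'.1, ht'.2.trans hxb⟩) (hE t ht')
              (norm_nonneg _) hM0'
          _ = M' := mul_one _
      · rw [abs_of_nonneg (by linarith)]
        exact mul_le_mul_of_nonneg_left (by linarith) hM0'
    have h5 : ∀ t ∈ Set.Icc s x, ‖g t * Complex.exp (c * (t - t₀))‖ ≤ M := fun t ht => by
      rw [norm_mul]
      calc _ ≤ M * 1 := mul_le_mul (hM t) (hE t ht) (norm_nonneg _) hM0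
        _ = M := mul_one _
    have h6 : ‖c‖ * ‖∫ t in s..x, g t * Complex.exp (c * (t - t₀))‖ ≤ 2 * M + b * M' := by
      rw [← norm_mul, eq_sub_iff_add_eq'.2 hp]
      have a1 := h5 s ⟨le_rfl, hsx⟩
      have a2 := h5 x ⟨hsx, le_rfl⟩
      refine (norm_sub_le _ _).trans ((add_le_add_left (norm_sub_le _ _) _).trans ?_)
      linarith
    have h7 : 2 * M + b * M' ≤ ‖c‖ * (δ / 2) := by
      rw [← div_le_iff₀ (half_pos hδ)]; linarith
    exact le_of_mul_le_mul_left (h6.trans h7) hc0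
  have hsplit : ∫ t in s..x, σ t * Complex.exp (c * (t - t₀)) =
      (∫ t in s..x, (σ t - g t) * Complex.exp (c * (t - t₀))) +
        ∫ t in s..x, g t * Complex.exp (c * (t - t₀)) := by
    have hi : IntervalIntegrable (fun t => g t * Complex.exp (c * (t - t₀))) volume s x :=
      (hg1.continuous.mul hcont).intervalIntegrable _ _
    rw [← intervalIntegral.integral_add ((hd.mono_set hsub).mul_continuousOn hcont.continuousOn) hi]
    congr 1; funext t; ring
  rw [hsplit]
  exact (norm_add_le _ _).trans (by linarith)

/-! ### Solutions of a Dirac type system for large frequency -/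

/-- The system solved by `U = exp(iρx)(y + iz/ρ)`, `V = exp(iρx)(y - iz/ρ)`, with `c = 2iρ`. -/
structure IsDiracSolution (σ r : ℝ → ℂ) (c : ℂ) (b : ℝ) (U V : ℝ → ℂ) : Prop where
  left : IsPrimitiveOn U (fun x => σ x * V x - r x * (U x + V x)) 0 b
  right : IsPrimitiveOn V (fun x => c * V x + σ x * U x + r x * (U x + V x)) 0 b

namespace IsDiracSolution

variable {σ r U V : ℝ → ℂ} {c : ℂ} {b : ℝ}

theorem isPrimitiveOn_exp_mul (hb : 0 ≤ b) (h : IsDiracSolution σ r c b U V) :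
    IsPrimitiveOn (fun x => Complex.exp (-c * x) * V x)
      (fun x => (σ x * U x + r x * (U x + V x)) * Complex.exp (-c * x)) 0 b :=
  ((IsPrimitiveOn.exp_mul (-c) 0 b).mul hb h.right).congr_deriv fun x => by ring

theorem right_eq (hb : 0 ≤ b) (h : IsDiracSolution σ r c b U V) {x : ℝ} (hx : x ∈ Set.Icc 0 b) :
    V x = Complex.exp (c * x) * V 0 +
      ∫ t in (0 : ℝ)..x, (σ t * U t + r t * (U t + V t)) * Complex.exp (-c * (t - x)) := by
  have h1 := (h.isPrimitiveOn_exp_mul hb).eq x hx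
  have h2 : ∫ t in (0 : ℝ)..x, (σ t * U t + r t * (U t + V t)) * Complex.exp (-c * (t - x)) =
      Complex.exp (c * x) * ∫ t in (0 : ℝ)..x,
        (σ t * U t + r t * (U t + V t)) * Complex.exp (-c * t) := by
    rw [← intervalIntegral.integral_const_mul]
    congr 1; funext t
    rw [mul_left_comm, ← Complex.exp_add]
    ring_nf
  have h3 : V x = Complex.exp (c * x) * (Complex.exp (-c * x) * V x) := by
    rw [← mul_assoc, ← Complex.exp_add]; simp
  rw [h2, h3, h1]
  simp [mul_add]

/-- As Re c ≤ 0, every exponential in the variation of constants formula `right_eq` has modulus at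
most 1. The large coefficient c thus never enters Gronwall's inequality, and the bound is uniform in
c. -/
theorem norm_le (hb : 0 ≤ b) (hc : c.re ≤ 0) (hσ : IntervalIntegrable σ volume 0 b)
    (hr : IntervalIntegrable r volume 0 b) (h : IsDiracSolution σ r c b U V) :
    ∀ x ∈ Set.Icc 0 b, ‖U x‖ + ‖V x‖ ≤ 2 * (‖U 0‖ + ‖V 0‖) *
      Real.exp (2 * ∫ t in (0 : ℝ)..b, (‖σ t‖ + 2 * ‖r t‖)) := by
  have hk : IntervalIntegrable (fun t => ‖σ t‖ + 2 * ‖r t‖) volume 0 b :=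
    hσ.norm.add (hr.norm.const_mul 2)
  have hUc := h.left.continuousOn hb
  have hVc := h.right.continuousOn hb
  have hg := gronwall (k := fun t => ‖σ t‖ + 2 * ‖r t‖) (f := fun x => ‖U x‖ + ‖V x‖)
    (a := ‖U 0‖ + ‖V 0‖) hb hk (fun t => by positivity) (hUc.norm.add hVc.norm) (by positivity) ?_
  · intro x hx
    refine (hg x hx).trans (mul_le_mul_of_nonneg_left (Real.exp_le_exp.2 ?_) (by positivity))
    refine mul_le_mul_of_nonneg_left ?_ two_pos.le
    exact intervalIntegral.integral_mono_interval le_rfl hx.1 hx.2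
      (Filter.Eventually.of_forall fun t => add_nonneg (norm_nonneg _)
        (mul_nonneg two_pos.le (norm_nonneg _))) hk
  · intro x hx
    have hsub : Set.uIcc 0 x ⊆ Set.uIcc 0 b := by
      rw [Set.uIcc_of_le hx.1, Set.uIcc_of_le hb]; exact Set.Icc_subset_Icc_right hx.2
    have hsub' : Set.uIcc 0 x ⊆ Set.Icc 0 b := by rwa [Set.uIcc_of_le hb] at hsub
    have hU' := (hUc.mono hsub').norm
    have hV' := (hVc.mono hsub').norm
    have hσ' := (hσ.mono_set hsub).norm
    have hr' := (hr.mono_set hsub).norm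
    have hi1 : IntervalIntegrable (fun t => ‖σ t‖ * ‖V t‖ + ‖r t‖ * (‖U t‖ + ‖V t‖)) volume 0 x :=
      (hσ'.mul_continuousOn hV').add (hr'.mul_continuousOn (hU'.add hV'))
    have hi2 : IntervalIntegrable (fun t => ‖σ t‖ * ‖U t‖ + ‖r t‖ * (‖U t‖ + ‖V t‖)) volume 0 x :=
      (hσ'.mul_continuousOn hU').add (hr'.mul_continuousOn (hU'.add hV'))
    have h1 : ‖U x‖ ≤ ‖U 0‖ + ∫ t in (0 : ℝ)..x, (‖σ t‖ * ‖V t‖ + ‖r t‖ * (‖U t‖ + ‖V t‖)) := by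
      rw [h.left.eq x hx]
      refine (norm_add_le _ _).trans (add_le_add_right ?_ _)
      refine intervalIntegral.norm_integral_le_of_norm_le hx.1
        (Filter.Eventually.of_forall fun t _ => ?_) hi1
      refine (norm_sub_le _ _).trans ?_
      rw [norm_mul, norm_mul]
      gcongr
      exact norm_add_le _ _
    have h2 : ‖V x‖ ≤ ‖V 0‖ + ∫ t in (0 : ℝ)..x, (‖σ t‖ * ‖U t‖ + ‖r t‖ * (‖U t‖ + ‖V t‖)) := by
      rw [h.right_eq hb hx]
      refine (norm_add_le _ _).trans (add_le_add ?_ ?_)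
      · rw [norm_mul, Complex.norm_exp]
        refine mul_le_of_le_one_left (norm_nonneg _) (Real.exp_le_one_iff.2 ?_)
        simpa using mul_nonpos_of_nonpos_of_nonneg hc hx.1
      · refine intervalIntegral.norm_integral_le_of_norm_le hx.1
          (Filter.Eventually.of_forall fun t ht => ?_) hi2
        rw [norm_mul]
        have hexp : ‖Complex.exp (-c * (t - x))‖ ≤ 1 := by
          rw [Complex.norm_exp]
          refine Real.exp_le_one_iff.2 ?_
          have : 0 ≤ x - t := by linarith [ht.2]
          simp
          nlinarith
        refine (mul_le_of_le_one_right (norm_nonneg _) hexp).trans ((norm_add_le _ _).trans ?_)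
        rw [norm_mul, norm_mul]
        gcongr
        exact norm_add_le _ _
    have h3 : ∫ t in (0 : ℝ)..x, (‖σ t‖ + 2 * ‖r t‖) * (‖U t‖ + ‖V t‖) =
        (∫ t in (0 : ℝ)..x, (‖σ t‖ * ‖V t‖ + ‖r t‖ * (‖U t‖ + ‖V t‖))) +
          ∫ t in (0 : ℝ)..x, (‖σ t‖ * ‖U t‖ + ‖r t‖ * (‖U t‖ + ‖V t‖)) := by
      rw [← intervalIntegral.integral_add hi1 hi2]
      congr 1; funext t; ring
    rw [h3]
    linarith

/-- The main term of U - U(0) is ∫ σ V. Put E(t) = ∫ₜˣ σ(s) exp(c s) ds and W(t) = exp(-c t) V(t);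
the derivative of W no longer contains c V. Integrating (E W)' turns ∫ σ V into E(0) V(0) plus an
integral against E(t) exp(-c t), and both factors E(0) and E(t) exp(-c t) are controlled by δ. -/
theorem norm_left_sub_le {B δ : ℝ} (hb : 0 ≤ b) (hσ : IntervalIntegrable σ volume 0 b)
    (hr : IntervalIntegrable r volume 0 b) (h : IsDiracSolution σ r c b U V)
    (hB : ∀ x ∈ Set.Icc 0 b, ‖U x‖ + ‖V x‖ ≤ B)
    (hδ : ∀ s x, 0 ≤ s → s ≤ x → x ≤ b → ‖∫ t in s..x, σ t * Complex.exp (c * (t - s))‖ ≤ δ) :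
    ∀ x ∈ Set.Icc 0 b, ‖U x - U 0‖ ≤ δ * B + δ * (∫ t in (0 : ℝ)..b, (‖σ t‖ + ‖r t‖)) * B +
      B * ∫ t in (0 : ℝ)..b, ‖r t‖ := by
  intro x hx
  have hδ0 : 0 ≤ δ := (norm_nonneg _).trans (hδ 0 0 le_rfl le_rfl hb)
  have hB0 : 0 ≤ B := (add_nonneg (norm_nonneg _) (norm_nonneg _)).trans (hB 0 ⟨le_rfl, hb⟩)
  have hsub : Set.uIcc 0 x ⊆ Set.uIcc 0 b := by
    rw [Set.uIcc_of_le hx.1, Set.uIcc_of_le hb]; exact Set.Icc_subset_Icc_right hx.2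
  have hsub' : Set.uIcc 0 x ⊆ Set.Icc 0 b := by rwa [Set.uIcc_of_le hb] at hsub
  have hUc := (h.left.continuousOn hb).mono hsub'
  have hVc := (h.right.continuousOn hb).mono hsub'
  have hσx := hσ.mono_set hsub
  have hrx := hr.mono_set hsub
  have hcont : Continuous fun t : ℝ => Complex.exp (c * t) := by fun_prop
  have hσe : IntervalIntegrable (fun t => σ t * Complex.exp (c * t)) volume 0 x :=
    hσx.mul_continuousOn hcont.continuousOn
  have hS := IsPrimitiveOn.of_integrable hσe
  have hconst : IsPrimitiveOn (fun _ => ∫ t in (0 : ℝ)..x, σ t * Complex.exp (c * t))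
      (fun _ => 0) 0 x := ⟨intervalIntegrable_const, fun _ _ => by simp⟩
  have hE := hconst.sub hx.1 hS
  have hW := (h.isPrimitiveOn_exp_mul hb).mono_right hx.1 hx.2
  have hEW := (hE.mul hx.1 hW).integral_eq_sub hx.1
  have hEc := hE.continuousOn hx.1
  rw [← Set.uIcc_of_le hx.1] at hEc
  have hEt : ∀ t ∈ Set.Icc 0 x, ‖((∫ s in (0 : ℝ)..x, σ s * Complex.exp (c * s)) -
      ∫ s in (0 : ℝ)..t, σ s * Complex.exp (c * s)) * Complex.exp (-c * t)‖ ≤ δ := fun t ht => by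
    have e1 := intervalIntegral.integral_interval_sub_left hσe (hσe.mono_set (by
      rw [Set.uIcc_of_le ht.1, Set.uIcc_of_le hx.1]; exact Set.Icc_subset_Icc_right ht.2))
    rw [e1, ← intervalIntegral.integral_mul_const]
    have e2 : ∀ s : ℝ, σ s * Complex.exp (c * s) * Complex.exp (-c * t) =
        σ s * Complex.exp (c * (s - t)) := fun s => by
      rw [mul_assoc, ← Complex.exp_add]; ring_nf
    simp only [e2]
    exact hδ t x ht.1 ht.2 hx.2
  have hi1 : IntervalIntegrable (fun t => σ t * V t) volume 0 x := hσx.mul_continuousOn hVc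
  have hF : IntervalIntegrable (fun t => σ t * U t + r t * (U t + V t)) volume 0 x :=
    (hσx.mul_continuousOn hUc).add (hrx.mul_continuousOn (hUc.add hVc))
  have hcontn : Continuous fun t : ℝ => Complex.exp (-c * t) := by fun_prop
  have hi2 : IntervalIntegrable (fun t => (σ t * U t + r t * (U t + V t)) *
      (((∫ s in (0 : ℝ)..x, σ s * Complex.exp (c * s)) -
      ∫ s in (0 : ℝ)..t, σ s * Complex.exp (c * s)) * Complex.exp (-c * t))) volume 0 x :=
    hF.mul_continuousOn (hEc.mul hcontn.continuousOn)
  have hσV : ∫ t in (0 : ℝ)..x, σ t * V t =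
      (∫ t in (0 : ℝ)..x, σ t * Complex.exp (c * t)) * V 0 +
      ∫ t in (0 : ℝ)..x, (σ t * U t + r t * (U t + V t)) *
      (((∫ s in (0 : ℝ)..x, σ s * Complex.exp (c * s)) -
      ∫ s in (0 : ℝ)..t, σ s * Complex.exp (c * s)) * Complex.exp (-c * t)) := by
    have e1 : ∀ t : ℝ, (0 - σ t * Complex.exp (c * t)) * (Complex.exp (-c * t) * V t) =
        -(σ t * V t) := fun t => by
      have : Complex.exp (c * t) * Complex.exp (-c * t) = 1 := by
        rw [← Complex.exp_add]; simp
      linear_combination (-(σ t * V t)) * this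
    have e2 : ∀ t : ℝ, ((∫ s in (0 : ℝ)..x, σ s * Complex.exp (c * s)) -
        ∫ s in (0 : ℝ)..t, σ s * Complex.exp (c * s)) *
        ((σ t * U t + r t * (U t + V t)) * Complex.exp (-c * t)) =
        (σ t * U t + r t * (U t + V t)) * (((∫ s in (0 : ℝ)..x, σ s * Complex.exp (c * s)) -
        ∫ s in (0 : ℝ)..t, σ s * Complex.exp (c * s)) * Complex.exp (-c * t)) := fun t => by ring
    simp only [e1, e2] at hEW
    have hi3 : IntervalIntegrable (fun t => -(σ t * V t)) volume 0 x := hi1.neg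
    rw [intervalIntegral.integral_add hi3 hi2, intervalIntegral.integral_neg] at hEW
    simp only [sub_self, zero_mul, intervalIntegral.integral_same, sub_zero, zero_sub,
      Complex.ofReal_zero, mul_zero, Complex.exp_zero, one_mul] at hEW
    linear_combination -hEW
  have hU : U x - U 0 = (∫ t in (0 : ℝ)..x, σ t * Complex.exp (c * t)) * V 0 +
      (∫ t in (0 : ℝ)..x, (σ t * U t + r t * (U t + V t)) *
      (((∫ s in (0 : ℝ)..x, σ s * Complex.exp (c * s)) -
      ∫ s in (0 : ℝ)..t, σ s * Complex.exp (c * s)) * Complex.exp (-c * t))) -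
      ∫ t in (0 : ℝ)..x, r t * (U t + V t) := by
    have hi3 : IntervalIntegrable (fun t => r t * (U t + V t)) volume 0 x :=
      hrx.mul_continuousOn (hUc.add hVc)
    rw [← hσV, ← intervalIntegral.integral_sub hi1 hi3,
      h.left.eq x hx]
    ring
  rw [hU]
  refine (norm_sub_le _ _).trans (add_le_add ((norm_add_le _ _).trans (add_le_add ?_ ?_)) ?_)
  · rw [norm_mul]
    have h1 := hδ 0 x le_rfl hx.1 hx.2
    simp only [Complex.ofReal_zero, sub_zero] at h1
    have h2 := hB 0 ⟨le_rfl, hb⟩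
    exact mul_le_mul h1 (by linarith [norm_nonneg (U 0)]) (norm_nonneg _) hδ0
  · have h1 : ‖∫ t in (0 : ℝ)..x, (σ t * U t + r t * (U t + V t)) *
      (((∫ s in (0 : ℝ)..x, σ s * Complex.exp (c * s)) -
      ∫ s in (0 : ℝ)..t, σ s * Complex.exp (c * s)) * Complex.exp (-c * t))‖ ≤
      ∫ t in (0 : ℝ)..x, (‖σ t‖ + ‖r t‖) * (B * δ) := by
      refine intervalIntegral.norm_integral_le_of_norm_le hx.1
        (Filter.Eventually.of_forall fun t ht => ?_) ((hσx.norm.add hrx.norm).mul_const _)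
      have htx := Set.Ioc_subset_Icc_self ht
      have hBt := hB t ⟨htx.1, htx.2.trans hx.2⟩
      rw [norm_mul, ← mul_assoc]
      refine mul_le_mul ?_ (hEt t htx) (norm_nonneg _) (by positivity)
      refine (norm_add_le _ _).trans ?_
      rw [norm_mul, norm_mul, add_mul]
      gcongr
      · linarith [norm_nonneg (V t)]
      · exact (norm_add_le _ _).trans hBt
    rw [intervalIntegral.integral_mul_const] at h1
    refine h1.trans ?_
    have h2 : ∫ t in (0 : ℝ)..x, (‖σ t‖ + ‖r t‖) ≤ ∫ t in (0 : ℝ)..b, (‖σ t‖ + ‖r t‖) :=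
      intervalIntegral.integral_mono_interval le_rfl hx.1 hx.2
        (Filter.Eventually.of_forall fun t => add_nonneg (norm_nonneg _) (norm_nonneg _))
        (hσ.norm.add hr.norm)
    calc _ ≤ (∫ t in (0 : ℝ)..b, (‖σ t‖ + ‖r t‖)) * (B * δ) :=
          mul_le_mul_of_nonneg_right h2 (by positivity)
      _ = _ := by ring
  · exact norm_intervalIntegral_mul_le le_rfl hx.1 hx.2 hr fun t ht =>
      (norm_add_le _ _).trans (hB t ⟨ht.1, ht.2.trans hx.2⟩)

/-- In `right_eq`, write U = U(0) + (U - U(0)): the constant part meets an oscillatory integral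
bounded by δ, the rest is bounded by η. -/
theorem norm_right_sub_le {B δ η : ℝ} (hb : 0 ≤ b) (hc : c.re ≤ 0)
    (hσ : IntervalIntegrable σ volume 0 b)
    (hr : IntervalIntegrable r volume 0 b) (h : IsDiracSolution σ r c b U V)
    (hB : ∀ x ∈ Set.Icc 0 b, ‖U x‖ + ‖V x‖ ≤ B)
    (hδ : ∀ x, 0 ≤ x → x ≤ b → ‖∫ t in (0 : ℝ)..x, σ t * Complex.exp (-c * (t - x))‖ ≤ δ)
    (hη : ∀ x ∈ Set.Icc 0 b, ‖U x - U 0‖ ≤ η) :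
    ∀ x ∈ Set.Icc 0 b, ‖V x - Complex.exp (c * x) * V 0‖ ≤
      δ * B + η * (∫ t in (0 : ℝ)..b, ‖σ t‖) + B * ∫ t in (0 : ℝ)..b, ‖r t‖ := by
  intro x hx
  have hδ0 : 0 ≤ δ := (norm_nonneg _).trans (hδ 0 le_rfl hb)
  have hB0 : 0 ≤ B := (add_nonneg (norm_nonneg _) (norm_nonneg _)).trans (hB 0 ⟨le_rfl, hb⟩)
  have hη0 : 0 ≤ η := (norm_nonneg _).trans (hη 0 ⟨le_rfl, hb⟩)
  have hsub : Set.uIcc 0 x ⊆ Set.uIcc 0 b := by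
    rw [Set.uIcc_of_le hx.1, Set.uIcc_of_le hb]; exact Set.Icc_subset_Icc_right hx.2
  have hsub' : Set.uIcc 0 x ⊆ Set.Icc 0 b := by rwa [Set.uIcc_of_le hb] at hsub
  have hUc := (h.left.continuousOn hb).mono hsub'
  have hVc := (h.right.continuousOn hb).mono hsub'
  have hσx := hσ.mono_set hsub
  have hrx := hr.mono_set hsub
  have hcont : Continuous fun t : ℝ => Complex.exp (-c * (t - x)) := by fun_prop
  have hexp : ∀ t ∈ Set.Icc 0 x, ‖Complex.exp (-c * (t - x))‖ ≤ 1 := fun t ht => by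
    rw [Complex.norm_exp]
    refine Real.exp_le_one_iff.2 ?_
    have : 0 ≤ x - t := by linarith [ht.2]
    simp
    nlinarith
  have hV : V x - Complex.exp (c * x) * V 0 =
      U 0 * (∫ t in (0 : ℝ)..x, σ t * Complex.exp (-c * (t - x))) +
      (∫ t in (0 : ℝ)..x, σ t * ((U t - U 0) * Complex.exp (-c * (t - x)))) +
      ∫ t in (0 : ℝ)..x, r t * ((U t + V t) * Complex.exp (-c * (t - x))) := by
    have hi1 : IntervalIntegrable (fun t => U 0 * (σ t * Complex.exp (-c * (t - x)))) volume 0 x :=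
      (hσx.mul_continuousOn hcont.continuousOn).const_mul _
    have hi2 : IntervalIntegrable (fun t => σ t * ((U t - U 0) * Complex.exp (-c * (t - x))))
        volume 0 x :=
      hσx.mul_continuousOn ((hUc.sub continuousOn_const).mul hcont.continuousOn)
    have hi3 : IntervalIntegrable (fun t => r t * ((U t + V t) * Complex.exp (-c * (t - x))))
        volume 0 x :=
      hrx.mul_continuousOn ((hUc.add hVc).mul hcont.continuousOn)
    rw [h.right_eq hb hx, ← intervalIntegral.integral_const_mul,
      ← intervalIntegral.integral_add hi1 hi2, ← intervalIntegral.integral_add (hi1.add hi2) hi3,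
      add_sub_cancel_left]
    congr 1; funext t; ring
  rw [hV]
  refine (norm_add_le _ _).trans (add_le_add ((norm_add_le _ _).trans (add_le_add ?_ ?_)) ?_)
  · rw [norm_mul, mul_comm]
    have h2 := hB 0 ⟨le_rfl, hb⟩
    exact mul_le_mul (hδ x hx.1 hx.2) (by linarith [norm_nonneg (V 0)]) (norm_nonneg _) hδ0
  · refine norm_intervalIntegral_mul_le le_rfl hx.1 hx.2 hσ fun t ht => ?_
    rw [norm_mul]
    calc _ ≤ η * 1 := mul_le_mul (hη t ⟨ht.1, ht.2.trans hx.2⟩) (hexp t ht) (norm_nonneg _) hη0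
      _ = η := mul_one _
  · refine norm_intervalIntegral_mul_le le_rfl hx.1 hx.2 hr fun t ht => ?_
    rw [norm_mul]
    calc _ ≤ B * 1 := mul_le_mul ((norm_add_le _ _).trans (hB t ⟨ht.1, ht.2.trans hx.2⟩))
          (hexp t ht) (norm_nonneg _) hB0
      _ = B := mul_one _

end IsDiracSolution

end SturmLiouville

/-! ### Asymptotics for large spectral parameter -/

namespace SturmLiouville

variable {σ : ℝ → ℂ}

/-- The factor exp(iρx) compensates the growth exp(x Im ρ), and the sign combinations diagonalise
the part of the system that is free of σ. What remains is σ, independent of ρ, and a coefficient of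
order σ²/ρ. -/
theorem IsSolution.isDiracSolution {ρ : ℂ} {y z : ℝ → ℂ} (hρ : ρ ≠ 0)
    (h : IsSolution σ (ρ ^ 2) y z) :
    IsDiracSolution σ (fun t => Complex.I / (2 * ρ) * σ t ^ 2) (2 * Complex.I * ρ) Real.pi
      (fun x => Complex.exp (Complex.I * ρ * x) * (y x + Complex.I / ρ * z x))
      (fun x => Complex.exp (Complex.I * ρ * x) * (y x - Complex.I / ρ * z x)) := by
  have hπ := Real.pi_pos.le
  have hI := Complex.I_sq
  have hE := IsPrimitiveOn.exp_mul (Complex.I * ρ) 0 Real.pi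
  have hz := h.isPrimitiveOn_quasi.const_mul (Complex.I / ρ)
  refine ⟨(hE.mul hπ (h.isPrimitiveOn.add hπ hz)).congr_deriv fun x => ?_,
    (hE.mul hπ (h.isPrimitiveOn.sub hπ hz)).congr_deriv fun x => ?_⟩
  · field_simp
    linear_combination (2 * ρ ^ 2 * z x) * hI
  · field_simp
    linear_combination (2 * ρ ^ 2 * z x) * hI

theorem isDiracSolution_symm_left {ρ u v E : ℂ} {y z : ℂ} (hE : E ≠ 0)
    (hu : u = E * (y + Complex.I / ρ * z)) (hv : v = E * (y - Complex.I / ρ * z)) :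
    y = E⁻¹ * (u + v) / 2 := by
  subst hu hv
  field_simp
  ring

theorem isDiracSolution_symm_right {ρ u v E : ℂ} {y z : ℂ} (hE : E ≠ 0) (hρ : ρ ≠ 0)
    (hu : u = E * (y + Complex.I / ρ * z)) (hv : v = E * (y - Complex.I / ρ * z)) :
    z = -(Complex.I * ρ / 2) * (E⁻¹ * (u - v)) := by
  subst hu hv
  field_simp
  linear_combination (2 * z) * Complex.I_sq

theorem norm_exp_I_mul_inv (ρ : ℂ) (x : ℝ) :
    ‖(Complex.exp (Complex.I * ρ * x))⁻¹‖ = Real.exp (ρ.im * x) := by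
  rw [← Complex.exp_neg, Complex.norm_exp]
  simp

theorem exists_bound_dirac (hσ : MemLp σ 2 intervalMeasure) (a c : ℂ) :
    ∃ B, 0 ≤ B ∧ ∀ ρ : ℂ, 0 ≤ ρ.im → 1 ≤ ‖ρ‖ → ∀ y z, IsSolution σ (ρ ^ 2) y z → y 0 = a → z 0 = c →
      ∀ x ∈ Set.Icc 0 Real.pi,
        ‖Complex.exp (Complex.I * ρ * x) * (y x + Complex.I / ρ * z x)‖ +
        ‖Complex.exp (Complex.I * ρ * x) * (y x - Complex.I / ρ * z x)‖ ≤ B := by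
  have hπ := Real.pi_pos.le
  have h1 := intervalIntegrable_of_memLp hσ
  have h2 := intervalIntegrable_sq_of_memLp hσ
  refine ⟨4 * (‖a‖ + ‖c‖) * Real.exp (2 * ∫ t in (0 : ℝ)..Real.pi, (‖σ t‖ + ‖σ t ^ 2‖)),
    by positivity, fun ρ him hρ y z h ha hc x hx => ?_⟩
  have hρ0 : ρ ≠ 0 := norm_pos_iff.1 (by linarith)
  have hD := (h.isDiracSolution hρ0).norm_le hπ (by simpa using him) h1 (h2.const_mul _) x hx
  refine hD.trans (mul_le_mul ?_ (Real.exp_le_exp.2 ?_) (Real.exp_pos _).le (by positivity))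
  · simp only [ha, hc, Complex.ofReal_zero, mul_zero, Complex.exp_zero, one_mul]
    have e : ‖Complex.I / ρ * c‖ ≤ ‖c‖ := by
      rw [norm_mul, norm_div, Complex.norm_I]
      exact mul_le_of_le_one_left (norm_nonneg _) ((div_le_one (by linarith)).2 hρ)
    have e1 := norm_add_le a (Complex.I / ρ * c)
    have e2 := norm_sub_le a (Complex.I / ρ * c)
    linarith
  · refine mul_le_mul_of_nonneg_left ?_ two_pos.le
    refine intervalIntegral.integral_mono_on hπ (h1.norm.add ((h2.const_mul _).norm.const_mul 2))
      (h1.norm.add h2.norm) fun t _ => ?_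
    rw [norm_mul]
    have : ‖Complex.I / (2 * ρ)‖ ≤ 1 / 2 := by
      rw [norm_div, Complex.norm_I, norm_mul]
      refine one_div_le_one_div_of_le two_pos ?_
      simp; linarith
    have := mul_le_mul_of_nonneg_right this (norm_nonneg (σ t ^ 2))
    linarith

theorem exists_bound_solution (hσ : MemLp σ 2 intervalMeasure) (a c : ℂ) :
    ∃ C, 0 ≤ C ∧ ∀ ρ : ℂ, 0 ≤ ρ.im → 1 ≤ ‖ρ‖ → ∀ y z, IsSolution σ (ρ ^ 2) y z → y 0 = a → z 0 = c →
      ∀ x ∈ Set.Icc 0 Real.pi, ‖y x‖ ≤ C * Real.exp (ρ.im * x) := by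
  obtain ⟨B, hB0, hB⟩ := exists_bound_dirac hσ a c
  refine ⟨B, hB0, fun ρ him hρ y z h ha hc x hx => ?_⟩
  have hb := hB ρ him hρ y z h ha hc x hx
  rw [isDiracSolution_symm_left (ρ := ρ) (z := z x) (y := y x)
    (Complex.exp_ne_zero (Complex.I * ρ * x)) rfl rfl, mul_div_assoc, norm_mul, norm_exp_I_mul_inv,
    mul_comm]
  refine mul_le_mul_of_nonneg_right ?_ (Real.exp_pos _).le
  rw [norm_div]
  simp only [Complex.norm_ofNat]
  have := norm_add_le (Complex.exp (Complex.I * ρ * x) * (y x + Complex.I / ρ * z x))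
    (Complex.exp (Complex.I * ρ * x) * (y x - Complex.I / ρ * z x))
  linarith

theorem exists_asymptotics_dirac (hσ : MemLp σ 2 intervalMeasure) {ε : ℝ} (hε : 0 < ε) :
    ∃ R, 1 ≤ R ∧ ∀ ρ : ℂ, 0 ≤ ρ.im → R ≤ ‖ρ‖ → ∀ y z, IsSolution σ (ρ ^ 2) y z →
      y 0 = 1 → z 0 = 0 → ∀ x ∈ Set.Icc 0 Real.pi,
        ‖Complex.exp (Complex.I * ρ * x) * (y x + Complex.I / ρ * z x) - 1‖ ≤ ε ∧
        ‖Complex.exp (Complex.I * ρ * x) * (y x - Complex.I / ρ * z x) -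
          Complex.exp (2 * Complex.I * ρ * x)‖ ≤ ε := by
  have hπ := Real.pi_pos.le
  have h1 := intervalIntegrable_of_memLp hσ
  have h2 := intervalIntegrable_sq_of_memLp hσ
  obtain ⟨B, hB0, hB⟩ := exists_bound_dirac hσ 1 0
  set S := ∫ t in (0 : ℝ)..Real.pi, ‖σ t‖ with hS
  set J := ∫ t in (0 : ℝ)..Real.pi, ‖σ t ^ 2‖ with hJ
  have hS0 : 0 ≤ S := intervalIntegral.integral_nonneg hπ fun t _ => norm_nonneg _
  have hJ0 : 0 ≤ J := intervalIntegral.integral_nonneg hπ fun t _ => norm_nonneg _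
  -- With δ bounding the oscillatory integrals and ∫ ‖r‖, and δ ≤ 1, the two estimates become δ B (S
  -- + 3) for U and δ (2 B + B (S + 3) S) for V. K dominates both factors, and the 1 makes it
  -- positive.
  set K := B * (S + 3) + 2 * B + B * (S + 3) * S + 1 with hK
  have hK0 : 0 < K := by positivity
  set δ := min 1 (ε / K) with hδ
  have hδ0 : 0 < δ := lt_min one_pos (by positivity)
  have hδ1 : δ ≤ 1 := min_le_left _ _
  have hδK : δ * K ≤ ε := by
    rw [← le_div_iff₀ hK0]; exact min_le_right _ _
  obtain ⟨R₀, hR₀⟩ := riemannLebesgue_uniform hπ h1 hδ0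
  -- J / δ is there because ∫ ‖r‖ = J / (2 ‖ρ‖) has to be at most δ.
  refine ⟨max 1 (max R₀ (J / δ)), le_max_left _ _, fun ρ him hρ y z h hy hz x hx => ?_⟩
  have hρ1 : 1 ≤ ‖ρ‖ := (le_max_left _ _).trans hρ
  have hρR : R₀ ≤ ‖ρ‖ := (le_max_left _ _).trans ((le_max_right _ _).trans hρ)
  have hρJ : J / δ ≤ ‖ρ‖ := (le_max_right _ _).trans ((le_max_right _ _).trans hρ)
  have hρ0 : ρ ≠ 0 := norm_pos_iff.1 (by linarith)
  have hD := h.isDiracSolution hρ0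
  have hbd := hB ρ him hρ1 y z h hy hz
  have hr : ∫ t in (0 : ℝ)..Real.pi, ‖Complex.I / (2 * ρ) * σ t ^ 2‖ ≤ δ := by
    have e : ∀ t, ‖Complex.I / (2 * ρ) * σ t ^ 2‖ = 1 / (2 * ‖ρ‖) * ‖σ t ^ 2‖ := fun t => by
      rw [norm_mul, norm_div, Complex.norm_I, norm_mul, Complex.norm_ofNat]
    simp only [e]
    rw [intervalIntegral.integral_const_mul, ← hJ, one_div_mul_eq_div, div_le_iff₀ (by positivity)]
    rw [div_le_iff₀ hδ0] at hρJ
    nlinarith [norm_nonneg ρ]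
  have hr0 : 0 ≤ ∫ t in (0 : ℝ)..Real.pi, ‖Complex.I / (2 * ρ) * σ t ^ 2‖ :=
    intervalIntegral.integral_nonneg hπ fun t _ => norm_nonneg _
  have hc2 : ‖2 * Complex.I * ρ‖ = 2 * ‖ρ‖ := by simp
  have hcre : (2 * Complex.I * ρ).re = -(2 * ρ.im) := by simp
  have hrl1 : ∀ s x, 0 ≤ s → s ≤ x → x ≤ Real.pi →
      ‖∫ t in s..x, σ t * Complex.exp (2 * Complex.I * ρ * (t - s))‖ ≤ δ := fun s x hs hsx hx => by
    refine hR₀ _ _ _ _ (by rw [hc2]; linarith) hs hsx hx fun t ht => ?_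
    rw [← Complex.ofReal_sub, Complex.re_mul_ofReal, hcre]
    nlinarith [ht.1]
  have hrl2 : ∀ x, 0 ≤ x → x ≤ Real.pi →
      ‖∫ t in (0 : ℝ)..x, σ t * Complex.exp (-(2 * Complex.I * ρ) * (t - x))‖ ≤ δ := fun x h0 hx => by
    refine hR₀ _ _ _ _ (by rw [norm_neg, hc2]; linarith) le_rfl h0 hx fun t ht => ?_
    rw [← Complex.ofReal_sub, Complex.re_mul_ofReal, Complex.neg_re, hcre]
    nlinarith [ht.2]
  have hU := hD.norm_left_sub_le hπ h1 (h2.const_mul _) hbd hrl1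
  have hsum : ∫ t in (0 : ℝ)..Real.pi, (‖σ t‖ + ‖Complex.I / (2 * ρ) * σ t ^ 2‖) ≤ S + 1 := by
    rw [intervalIntegral.integral_add h1.norm (h2.const_mul _).norm]
    linarith
  have hU' : ∀ x ∈ Set.Icc 0 Real.pi, _ ≤ δ * (B * (S + 3)) := fun x hx => (hU x hx).trans (by
    have e1 := mul_le_mul_of_nonneg_right (mul_le_mul_of_nonneg_left hsum hδ0.le) hB0
    have e2 := mul_le_mul_of_nonneg_left hr hB0
    nlinarith)
  have hV := hD.norm_right_sub_le hπ (by rw [hcre]; linarith) h1 (h2.const_mul _) hbd hrl2 hU' x hx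
  have hUx := hU' x hx
  simp only [hy, hz, Complex.ofReal_zero, mul_zero, Complex.exp_zero, add_zero,
    sub_zero, mul_one] at hUx hV
  have hBS : 0 ≤ δ * (B * (S + 3) * S) := by positivity
  have hBS' : 0 ≤ δ * (B * (S + 3)) := by positivity
  have hBS'' : 0 ≤ δ * B := by positivity
  constructor
  · refine hUx.trans (le_trans ?_ hδK)
    rw [hK]; nlinarith
  · refine hV.trans (le_trans ?_ hδK)
    have e2 := mul_le_mul_of_nonneg_left hr hB0
    rw [hK, ← hS]; nlinarith

/-- Undoing the change of variables with E = exp(iρx): cos(ρx) = (E + E⁻¹)/2 corresponds to U = 1, V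
= E², and ‖E⁻¹‖ = exp(x Im ρ). -/
theorem exists_asymptotics (hσ : MemLp σ 2 intervalMeasure) {ε : ℝ} (hε : 0 < ε) :
    ∃ R, 1 ≤ R ∧ ∀ ρ : ℂ, 0 ≤ ρ.im → R ≤ ‖ρ‖ → ∀ y z, IsSolution σ (ρ ^ 2) y z →
      y 0 = 1 → z 0 = 0 → ∀ x ∈ Set.Icc 0 Real.pi,
        ‖y x - Complex.cos (ρ * x)‖ ≤ ε * Real.exp (ρ.im * x) ∧
        ‖z x + ρ * Complex.sin (ρ * x)‖ ≤ ε * ‖ρ‖ * Real.exp (ρ.im * x) := by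
  obtain ⟨R, hR1, hR⟩ := exists_asymptotics_dirac hσ hε
  refine ⟨R, hR1, fun ρ him hρ y z h hy hz x hx => ?_⟩
  obtain ⟨hU, hV⟩ := hR ρ him hρ y z h hy hz x hx
  have hρ0 : ρ ≠ 0 := norm_pos_iff.1 (by linarith)
  have hE := Complex.exp_ne_zero (Complex.I * ρ * x)
  have ey := isDiracSolution_symm_left (ρ := ρ) (z := z x) (y := y x) hE rfl rfl
  have ez := isDiracSolution_symm_right (ρ := ρ) (z := z x) (y := y x) hE hρ0 rfl rfl
  set U := Complex.exp (Complex.I * ρ * x) * (y x + Complex.I / ρ * z x)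
  set V := Complex.exp (Complex.I * ρ * x) * (y x - Complex.I / ρ * z x)
  have hn := norm_exp_I_mul_inv ρ x
  have e2 : Complex.exp (2 * Complex.I * ρ * x) = Complex.exp (Complex.I * ρ * x) ^ 2 := by
    rw [← Complex.exp_nat_mul]; ring_nf
  have ecos : Complex.cos (ρ * x) = ((Complex.exp (Complex.I * ρ * x)) +
      (Complex.exp (Complex.I * ρ * x))⁻¹) / 2 := by
    rw [Complex.cos, ← Complex.exp_neg]; ring_nf
  have esin : Complex.sin (ρ * x) = ((Complex.exp (Complex.I * ρ * x))⁻¹ -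
      Complex.exp (Complex.I * ρ * x)) * Complex.I / 2 := by
    rw [Complex.sin, ← Complex.exp_neg]; ring_nf
  rw [e2] at hV
  generalize Complex.exp (Complex.I * ρ * x) = E at *
  constructor
  · have e : y x - Complex.cos (ρ * x) = E⁻¹ * ((U - 1) / 2 + (V - E ^ 2) / 2) := by
      rw [ey, ecos]; field_simp; ring
    rw [e, norm_mul, hn, mul_comm]
    refine mul_le_mul_of_nonneg_right ((norm_add_le _ _).trans ?_) (Real.exp_pos _).le
    rw [norm_div, norm_div, Complex.norm_ofNat]; linarith
  · have e : z x + ρ * Complex.sin (ρ * x) =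
        -(Complex.I * ρ) * (E⁻¹ * ((U - 1) / 2 - (V - E ^ 2) / 2)) := by
      rw [ez, esin]; field_simp; ring
    rw [e, norm_mul, norm_neg, norm_mul, norm_mul, hn, Complex.norm_I, one_mul]
    have : ‖(U - 1) / 2 - (V - E ^ 2) / 2‖ ≤ ε := by
      refine (norm_sub_le _ _).trans ?_
      rw [norm_div, norm_div, Complex.norm_ofNat]; linarith
    calc _ ≤ ‖ρ‖ * (Real.exp (ρ.im * x) * ε) := by gcongr
      _ = _ := by ring

/-! ### Entire quotients that vanish identically -/

theorem exists_differentiable_quotient {N D : ℂ → ℂ} (hN : Differentiable ℂ N)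
    (hD : Differentiable ℂ D) (hD0 : ∃ μ, D μ ≠ 0)
    (hord : ∀ μ, analyticOrderAt D μ ≤ analyticOrderAt N μ) :
    ∃ F : ℂ → ℂ, Differentiable ℂ F ∧ ∀ μ, N μ = F μ * D μ := by
  have htop : ∀ μ, analyticOrderAt D μ ≠ ⊤ := by
    obtain ⟨μ₀, hμ₀⟩ := hD0
    intro μ
    refine AnalyticOnNhd.analyticOrderAt_ne_top_of_isPreconnected (U := Set.univ)
      (fun z _ => hD.analyticAt z) isPreconnected_univ (Set.mem_univ μ₀) (Set.mem_univ μ) ?_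
    rw [(hD.analyticAt μ₀).analyticOrderAt_eq_zero.2 hμ₀]
    simp
  have hloc : ∀ μ, ∃ h : ℂ → ℂ, AnalyticAt ℂ h μ ∧ ∀ᶠ z in nhds μ, N z = h z * D z := by
    intro μ
    obtain ⟨d, hd, hd0, hDd⟩ := (hD.analyticAt μ).analyticOrderAt_ne_top.1 (htop μ)
    have hle : ((analyticOrderNatAt D μ : ℕ) : ℕ∞) ≤ analyticOrderAt N μ := by
      rw [Nat.cast_analyticOrderNatAt (htop μ)]; exact hord μ
    obtain ⟨g, hg, hNg⟩ := (natCast_le_analyticOrderAt (hN.analyticAt μ)).1 hle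
    refine ⟨fun z => g z / d z, hg.div hd hd0, ?_⟩
    filter_upwards [hDd, hNg, hd.continuousAt.eventually_ne hd0] with z h1 h2 h3
    rw [h1, h2, smul_eq_mul, smul_eq_mul]
    field_simp
  choose h hh hND using hloc
  have hne : ∀ μ, ∀ᶠ z in nhdsWithin μ {μ}ᶜ, D z ≠ 0 := by
    intro μ
    rcases (hD.analyticAt μ).eventually_eq_zero_or_eventually_ne_zero with h1 | h1
    · exact absurd (analyticOrderAt_eq_top.2 h1) (htop μ)
    · exact h1
  -- The local quotients agree near each point, since the zeros of D are isolated and the quotients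
  -- are continuous; their diagonal values therefore form an entire function.
  refine ⟨fun μ => h μ μ, fun μ => ?_, fun μ => (hND μ).self_of_nhds⟩
  have key : (fun z => h z z) =ᶠ[nhds μ] h μ := by
    filter_upwards [(hND μ).eventually_nhds, (hh μ).eventually_analyticAt] with ν h1 h2
    have h3 : h ν =ᶠ[nhdsWithin ν {ν}ᶜ] h μ := by
      filter_upwards [h1.filter_mono nhdsWithin_le_nhds, (hND ν).filter_mono nhdsWithin_le_nhds,
        hne ν] with z e1 e2 e3
      exact mul_right_cancel₀ e3 (e2.symm.trans e1)
    exact (((hh ν).continuousAt.eventuallyEq_nhds_iff_eventuallyEq_nhdsNE h2.continuousAt).1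
      h3).eq_of_nhds
  exact ((hh μ).differentiableAt).congr_of_eventuallyEq key

/-- An entire quotient `N / D`, evaluated at `ρ ^ 2`, that tends to zero along the boundaries of the
squares with half side `n + 1 / 2` vanishes identically. -/
theorem eq_zero_of_quotient_le {N D : ℂ → ℂ} (hN : Differentiable ℂ N)
    (hD : Differentiable ℂ D)
    (hord : ∀ μ, analyticOrderAt D μ ≤ analyticOrderAt N μ) {C R : ℝ}
    (hbound : ∀ (n : ℕ) (ρ : ℂ), 0 ≤ ρ.im → R ≤ n → (n : ℝ) ≤ ‖ρ‖ →
      (|ρ.re| = n + 1 / 2 ∨ ρ.im = n + 1 / 2) →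
      D (ρ ^ 2) ≠ 0 ∧ ‖N (ρ ^ 2)‖ * ‖ρ‖ ≤ C * ‖D (ρ ^ 2)‖) : ∀ μ, N μ = 0 := by
  have hD0 : ∃ μ, D μ ≠ 0 := by
    obtain ⟨n, hn⟩ := exists_nat_ge R
    have him : (Complex.I * ((n : ℝ) + 1 / 2 : ℝ)).im = n + 1 / 2 := by simp
    have hno : ‖Complex.I * ((n : ℝ) + 1 / 2 : ℝ)‖ = n + 1 / 2 := by
      rw [norm_mul, Complex.norm_I, one_mul, Complex.norm_real, Real.norm_of_nonneg (by positivity)]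
    exact ⟨_, (hbound n (Complex.I * ((n : ℝ) + 1 / 2 : ℝ)) (by rw [him]; positivity) hn
      (by rw [hno]; linarith) (Or.inr him)).1⟩
  obtain ⟨F, hF, hNF⟩ := exists_differentiable_quotient hN hD hD0 hord
  have hFb : ∀ (n : ℕ) (ρ : ℂ), R ≤ n → 1 ≤ n → (n : ℝ) ≤ ‖ρ‖ →
      (|ρ.re| = n + 1 / 2 ∨ |ρ.im| = n + 1 / 2) → ‖F (ρ ^ 2)‖ ≤ C / n := by
    have aux : ∀ (n : ℕ) (ρ : ℂ), 0 ≤ ρ.im → R ≤ n → 1 ≤ n → (n : ℝ) ≤ ‖ρ‖ →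
        (|ρ.re| = n + 1 / 2 ∨ ρ.im = n + 1 / 2) → ‖F (ρ ^ 2)‖ ≤ C / n := by
      intro n ρ him hR hn hρ hb
      obtain ⟨h1, h2⟩ := hbound n ρ him hR hρ hb
      rw [hNF, norm_mul] at h2
      have h3 : 0 < ‖D (ρ ^ 2)‖ := norm_pos_iff.2 h1
      have hn0 : (0 : ℝ) < n := by exact_mod_cast hn
      rw [le_div_iff₀ hn0]
      have h4 : ‖F (ρ ^ 2)‖ * ‖ρ‖ ≤ C := by
        refine le_of_mul_le_mul_right ?_ h3
        linarith
      exact (mul_le_mul_of_nonneg_left hρ (norm_nonneg _)).trans h4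
    intro n ρ hR hn hρ hb
    -- F(ρ²) is even in ρ, so estimates in the upper half plane suffice.
    rcases le_total 0 ρ.im with him | him
    · rw [abs_of_nonneg him] at hb
      exact aux n ρ him hR hn hρ hb
    · rw [abs_of_nonpos him] at hb
      have := aux n (-ρ) (by simpa using him) hR hn (by simpa using hρ) (by simpa using hb)
      simpa using this
  have hF0 : ∀ ρ, F (ρ ^ 2) = 0 := by
    intro ρ
    obtain ⟨n₀, hn₀⟩ := exists_nat_ge (max R (max 1 ‖ρ‖))
    have hle : ∀ n : ℕ, n₀ ≤ n → ‖F (ρ ^ 2)‖ ≤ C / n := by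
      intro n hn
      have hn' : (n₀ : ℝ) ≤ n := by exact_mod_cast hn
      have hnR : R ≤ n := (le_max_left _ _).trans (hn₀.trans hn')
      have hn1 : (1 : ℝ) ≤ n := (le_max_left _ _).trans ((le_max_right _ _).trans (hn₀.trans hn'))
      have hnρ : ‖ρ‖ ≤ n := (le_max_right _ _).trans ((le_max_right _ _).trans (hn₀.trans hn'))
      set a : ℝ := n + 1 / 2 with ha
      have ha0 : -a < a := by rw [ha]; linarith
      refine Complex.norm_le_of_forall_mem_frontier_norm_le
        (U := Set.Ioo (-a) a ×ℂ Set.Ioo (-a) a)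
        ((Metric.isBounded_Ioo _ _).reProdIm (Metric.isBounded_Ioo _ _))
        (f := fun ρ => F (ρ ^ 2)) (hF.comp (differentiable_id.pow 2)).diffContOnCl
        (fun w hw => ?_) (subset_closure ?_)
      · refine hFb n w hnR (by exact_mod_cast hn1) ?_ ?_
        · rw [Complex.frontier_reProdIm, closure_Ioo ha0.ne, frontier_Ioo ha0] at hw
          rcases hw with hw | hw
          · have h1 : |w.im| = a := by
              rcases hw.2 with h | h
              · rw [h, abs_neg, abs_of_nonneg (by linarith)]
              · rw [Set.mem_singleton_iff.1 h, abs_of_nonneg (by linarith)]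
            have := Complex.abs_im_le_norm w
            linarith
          · have h1 : |w.re| = a := by
              rcases hw.1 with h | h
              · rw [h, abs_neg, abs_of_nonneg (by linarith)]
              · rw [Set.mem_singleton_iff.1 h, abs_of_nonneg (by linarith)]
            have := Complex.abs_re_le_norm w
            linarith
        · rw [Complex.frontier_reProdIm, closure_Ioo ha0.ne, frontier_Ioo ha0] at hw
          rcases hw with hw | hw
          · right
            rcases hw.2 with h | h
            · rw [h, abs_neg, abs_of_nonneg (by linarith)]
            · rw [Set.mem_singleton_iff.1 h, abs_of_nonneg (by linarith)]
          · left
            rcases hw.1 with h | h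
            · rw [h, abs_neg, abs_of_nonneg (by linarith)]
            · rw [Set.mem_singleton_iff.1 h, abs_of_nonneg (by linarith)]
      · have h1 := Complex.abs_re_le_norm ρ
        have h2 := Complex.abs_im_le_norm ρ
        exact ⟨abs_lt.1 (by linarith), abs_lt.1 (by linarith)⟩
    have hlim : Filter.Tendsto (fun n : ℕ => C / (n : ℝ)) Filter.atTop (nhds 0) :=
      tendsto_const_div_atTop_nhds_zero_nat C
    have := ge_of_tendsto hlim (Filter.eventually_atTop.2 ⟨n₀, hle⟩)
    exact norm_le_zero_iff.1 this
  intro μ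
  obtain ⟨ρ, hρ⟩ := IsAlgClosed.exists_pow_nat_eq μ two_pos
  rw [hNF, ← hρ, hF0, zero_mul]

/-- If cos(Re w) = 0 then |sin w| = cosh(Im w). If Im w ≥ 1/2 then exp(2 Im w) ≥ 2, so the larger
exponential in sin w is at least twice the smaller. The two cases cover the vertical and the
horizontal sides of the squares. -/
theorem exp_le_norm_sin {w : ℂ} (h : Real.cos w.re = 0 ∨ 1 / 2 ≤ w.im) :
    Real.exp w.im / 4 ≤ ‖Complex.sin w‖ := by
  rcases h with h | h
  · have h1 : Complex.sin w = Complex.sin w.re * Complex.cosh w.im := by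
      conv_lhs => rw [← Complex.re_add_im w]
      rw [Complex.sin_add_mul_I, ← Complex.ofReal_cos, h]
      simp
    have h2 : |Real.sin w.re| = 1 := by
      have := Real.sin_sq_add_cos_sq w.re
      rw [h] at this
      rw [← sq_eq_sq₀ (abs_nonneg _) zero_le_one, sq_abs]
      linarith
    rw [h1, norm_mul, ← Complex.ofReal_sin, ← Complex.ofReal_cosh, Complex.norm_real,
      Complex.norm_real, Real.norm_eq_abs, h2, one_mul, Real.norm_of_nonneg (Real.cosh_pos _).le,
      Real.cosh_eq]
    have := Real.exp_pos w.im
    have := Real.exp_pos (-w.im)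
    linarith
  · have h1 : ‖Complex.exp (-w * Complex.I)‖ = Real.exp w.im := by
      rw [Complex.norm_exp]; simp
    have h2 : ‖Complex.exp (w * Complex.I)‖ = Real.exp (-w.im) := by
      rw [Complex.norm_exp]; simp
    have h3 : Real.exp (-w.im) ≤ Real.exp w.im / 2 := by
      have e1 : Real.exp w.im = Real.exp (-w.im) * Real.exp (2 * w.im) := by
        rw [← Real.exp_add]; ring_nf
      have e2 : 2 ≤ Real.exp (2 * w.im) := by
        have := Real.add_one_le_exp (2 * w.im)
        linarith
      have := mul_le_mul_of_nonneg_left e2 (Real.exp_pos (-w.im)).le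
      linarith
    rw [Complex.sin, norm_div, norm_mul, Complex.norm_I, mul_one, Complex.norm_ofNat]
    have := norm_sub_norm_le (Complex.exp (-w * Complex.I)) (Complex.exp (w * Complex.I))
    rw [h1, h2] at this
    linarith

end SturmLiouville

/-! ### Characteristic function, eigenvalues and weight numbers -/

namespace SturmLiouville

variable {σ : ℝ → ℂ}

theorem left_mem_Icc_pi : (0 : ℝ) ∈ Set.Icc 0 Real.pi := ⟨le_rfl, Real.pi_pos.le⟩

theorem right_mem_Icc_pi : Real.pi ∈ Set.Icc 0 Real.pi := ⟨Real.pi_pos.le, le_rfl⟩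

theorem phi_spec (hσ : MemLp σ 2 intervalMeasure) (μ : ℂ) :
    IsSolution σ μ (phi σ μ) (phiQuasi σ μ) ∧ phi σ μ 0 = 1 ∧ phiQuasi σ μ 0 = 0 := by
  obtain ⟨y, z, h, -⟩ := exists_isSolution_family hσ 1 0
  exact Classical.epsilon_spec
    (p := fun p : (ℝ → ℂ) × (ℝ → ℂ) => IsSolution σ μ p.1 p.2 ∧ p.1 0 = 1 ∧ p.2 0 = 0)
    ⟨(y μ, z μ), h μ⟩

theorem differentiable_phi (hσ : MemLp σ 2 intervalMeasure) {x : ℝ} (hx : x ∈ Set.Icc 0 Real.pi) :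
    (Differentiable ℂ fun μ => phi σ μ x) ∧ Differentiable ℂ fun μ => phiQuasi σ μ x := by
  obtain ⟨y, z, h, -, hy, hz⟩ := exists_isSolution_family hσ 1 0
  have heq : ∀ μ, phi σ μ x = y μ x ∧ phiQuasi σ μ x = z μ x := fun μ => by
    obtain ⟨h1, h2, h3⟩ := phi_spec hσ μ
    exact h1.eqOn hσ (h μ).1 (h2.trans (h μ).2.1.symm) (h3.trans (h μ).2.2.symm) x hx
  simp only [fun μ => (heq μ).1, fun μ => (heq μ).2]
  exact ⟨hy x, hz x⟩

theorem differentiable_characteristicFunction (hσ : MemLp σ 2 intervalMeasure) (H : ℂ) :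
    Differentiable ℂ (characteristicFunction σ H) :=
  (differentiable_phi hσ right_mem_Icc_pi).2.add
    ((differentiable_phi hσ right_mem_Icc_pi).1.const_mul H)

namespace IsSolution

variable {μ ν : ℂ} {y z f g : ℝ → ℂ}

theorem const_mul (c : ℂ) (h : IsSolution σ μ y z) :
    IsSolution σ μ (fun x => c * y x) (fun x => c * z x) :=
  of_isPrimitiveOn ((h.isPrimitiveOn.const_mul c).congr_deriv fun x => by ring)
    ((h.isPrimitiveOn_quasi.const_mul c).congr_deriv fun x => by ring)

/-- The quasi-derivative is designed so that all terms with σ and σ² cancel here. -/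
theorem wronskian (h : IsSolution σ μ y z) (h' : IsSolution σ ν f g) :
    IsPrimitiveOn (fun x => y x * g x - f x * z x) (fun x => (μ - ν) * (y x * f x)) 0 Real.pi :=
  ((h.isPrimitiveOn.mul Real.pi_pos.le h'.isPrimitiveOn_quasi).sub Real.pi_pos.le
    (h'.isPrimitiveOn.mul Real.pi_pos.le h.isPrimitiveOn_quasi)).congr_deriv fun x => by ring

theorem wronskian_eq (h : IsSolution σ μ y z) (h' : IsSolution σ μ f g) {x : ℝ}
    (hx : x ∈ Set.Icc 0 Real.pi) :
    y x * g x - f x * z x = y Real.pi * g Real.pi - f Real.pi * z Real.pi := by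
  have hw := (h.wronskian h').eq
  rw [hw x hx, hw _ right_mem_Icc_pi]
  simp

theorem eq_mul_phi (hσ : MemLp σ 2 intervalMeasure) (h : IsSolution σ μ y z) (h0 : z 0 = 0) :
    ∀ x ∈ Set.Icc 0 Real.pi, y x = y 0 * phi σ μ x ∧ z x = y 0 * phiQuasi σ μ x := by
  obtain ⟨h1, h2, h3⟩ := phi_spec hσ μ
  exact h.eqOn hσ (h1.const_mul (y 0)) (by simp [h2]) (by simp [h0, h3])

theorem congr_ae {σ' : ℝ → ℂ} (hσσ' : σ =ᵐ[intervalMeasure] σ') (h : IsSolution σ μ y z) :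
    IsSolution σ' μ y z where
  absCont := h.absCont
  absCont_quasi := h.absCont_quasi
  quasi_eq := by
    filter_upwards [h.quasi_eq, hσσ'] with x h1 h2
    rw [← h2]; exact h1
  eqn := by
    filter_upwards [h.eqn, hσσ'] with x h1 h2
    rw [← h2]; exact h1

end IsSolution

theorem IsPrimitiveOn.reflect {f f' : ℝ → ℂ} {b : ℝ} (hb : 0 ≤ b) (hf : IsPrimitiveOn f f' 0 b) :
    IsPrimitiveOn (fun x => f (b - x)) (fun x => -f' (b - x)) 0 b := by
  refine ⟨?_, fun x hx => ?_⟩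
  · have := (hf.integrable.comp_sub_left b).neg.symm
    rwa [sub_zero, sub_self] at this
  · rw [intervalIntegral.integral_neg, intervalIntegral.integral_comp_sub_left, sub_zero,
      hf.eq b ⟨hb, le_rfl⟩, hf.eq (b - x) ⟨by linarith [hx.2], by linarith [hx.1]⟩]
    have h1 : IntervalIntegrable f' volume 0 (b - x) := hf.integrable.mono_set (by
      rw [Set.uIcc_of_le (by linarith [hx.2]), Set.uIcc_of_le hb]
      exact Set.Icc_subset_Icc_right (by linarith [hx.1]))
    rw [← intervalIntegral.integral_interval_sub_left hf.integrable h1]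
    ring

theorem memLp_reflect (hσ : MemLp σ 2 intervalMeasure) :
    MemLp (fun x => -σ (Real.pi - x)) 2 intervalMeasure := by
  have hmp : MeasurePreserving (fun x : ℝ => Real.pi - x) intervalMeasure intervalMeasure := by
    have h := (Measure.measurePreserving_sub_left volume Real.pi).restrict_preimage
      (measurableSet_Ioo (a := (0 : ℝ)) (b := Real.pi))
    rwa [Set.preimage_const_sub_Ioo, sub_self, sub_zero] at h
  exact (hσ.comp_measurePreserving hmp).neg

/-- Lets solutions normalised at π inherit existence, analyticity and growth bounds from those
normalised at 0; the reflection changes the sign of both σ and the quasi-derivative. -/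
theorem IsSolution.reflect {μ : ℂ} {y z : ℝ → ℂ}
    (h : IsSolution (fun x => -σ (Real.pi - x)) μ y z) :
    IsSolution σ μ (fun x => y (Real.pi - x)) (fun x => -z (Real.pi - x)) := by
  refine IsSolution.of_isPrimitiveOn
    ((h.isPrimitiveOn.reflect Real.pi_pos.le).congr_deriv fun x => ?_)
    ((((h.isPrimitiveOn_quasi.reflect Real.pi_pos.le).const_mul (-1)).congr_deriv
      (g' := fun x => -(σ x * -z (Real.pi - x)) - σ x ^ 2 * y (Real.pi - x) -
        μ * y (Real.pi - x)) fun x => ?_).congr_fun fun x => ?_)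
  · simp only [sub_sub_cancel]; ring
  · simp only [sub_sub_cancel]; ring
  · ring

/-- `f(·, μ)` is the solution with `f(π, μ) = 1`, `f^[1](π, μ) = -H`, with its analyticity and
growth in the spectral parameter. -/
structure IsRightFamily (σ : ℝ → ℂ) (H : ℂ) (f g : ℂ → ℝ → ℂ) (C : ℝ) : Prop where
  isSolution : ∀ μ, IsSolution σ μ (f μ) (g μ)
  apply_pi : ∀ μ, f μ Real.pi = 1
  quasi_apply_pi : ∀ μ, g μ Real.pi = -H
  differentiable : ∀ x, Differentiable ℂ fun μ => f μ x
  nonneg : 0 ≤ C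
  bound : ∀ ρ : ℂ, 0 ≤ ρ.im → 1 ≤ ‖ρ‖ → ∀ x ∈ Set.Icc 0 Real.pi,
    ‖f (ρ ^ 2) x‖ ≤ C * Real.exp (ρ.im * (Real.pi - x))

theorem exists_isRightFamily (hσ : MemLp σ 2 intervalMeasure) (H : ℂ) :
    ∃ f g C, IsRightFamily σ H f g C := by
  obtain ⟨y, z, h, -, hy, -⟩ := exists_isSolution_family (memLp_reflect hσ) 1 H
  obtain ⟨C, hC0, hC⟩ := exists_bound_solution (memLp_reflect hσ) 1 H
  refine ⟨fun μ x => y μ (Real.pi - x), fun μ x => -z μ (Real.pi - x), C,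
    fun μ => (h μ).1.reflect, fun μ => ?_, fun μ => ?_, fun x => hy _, hC0,
    fun ρ him hρ x hx => ?_⟩
  · simp [(h μ).2.1]
  · simp [(h μ).2.2]
  · exact hC ρ him hρ _ _ (h _).1 (h _).2.1 (h _).2.2 _ ⟨by linarith [hx.2], by linarith [hx.1]⟩

namespace IsRightFamily

variable {H : ℂ} {f g : ℂ → ℝ → ℂ} {C : ℝ}

theorem wronskian_phi (h : IsRightFamily σ H f g C) (hσ : MemLp σ 2 intervalMeasure) (μ : ℂ)
    {x : ℝ} (hx : x ∈ Set.Icc 0 Real.pi) :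
    phi σ μ x * g μ x - f μ x * phiQuasi σ μ x = -characteristicFunction σ H μ := by
  rw [(phi_spec hσ μ).1.wronskian_eq (h.isSolution μ) hx, h.apply_pi, h.quasi_apply_pi,
    characteristicFunction]
  ring

/-- At a zero of Δ the Wronskian of φ and f vanishes. At x = 0 this says that f also satisfies the
left boundary condition, so f is a multiple of φ; the factor is fixed by f(π) = 1. -/
theorem apply_mul_phi (h : IsRightFamily σ H f g C) (hσ : MemLp σ 2 intervalMeasure) {μ : ℂ}
    (hμ : characteristicFunction σ H μ = 0) {x : ℝ} (hx : x ∈ Set.Icc 0 Real.pi) :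
    phi σ μ Real.pi * f μ x = phi σ μ x := by
  have h0 := h.wronskian_phi hσ μ left_mem_Icc_pi
  rw [(phi_spec hσ μ).2.1, (phi_spec hσ μ).2.2, hμ] at h0
  have hg0 : g μ 0 = 0 := by simpa using h0
  have hm := (h.isSolution μ).eq_mul_phi hσ hg0
  have h1 := (hm _ right_mem_Icc_pi).1
  rw [h.apply_pi] at h1
  rw [(hm x hx).1]
  linear_combination -(phi σ μ x) * h1

end IsRightFamily

theorem phi_pi_ne_zero (hσ : MemLp σ 2 intervalMeasure) {H μ : ℂ}
    (hμ : characteristicFunction σ H μ = 0) : phi σ μ Real.pi ≠ 0 := by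
  obtain ⟨f, g, C, h⟩ := exists_isRightFamily hσ H
  intro h0
  have := h.apply_mul_phi hσ hμ left_mem_Icc_pi
  rw [h0, (phi_spec hσ μ).2.1] at this
  simp at this

theorem isEigenvalue_iff (hσ : MemLp σ 2 intervalMeasure) (H μ : ℂ) :
    IsEigenvalue σ H μ ↔ characteristicFunction σ H μ = 0 := by
  constructor
  · rintro ⟨y, z, h, ⟨x, hx, hyx⟩, hz0, hπ⟩
    have hm := h.eq_mul_phi hσ hz0
    have hy0 : y 0 ≠ 0 := fun h0 => hyx (by rw [(hm x hx).1, h0, zero_mul])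
    rw [(hm _ right_mem_Icc_pi).1, (hm _ right_mem_Icc_pi).2] at hπ
    refine (mul_eq_zero.1 (?_ : y 0 * _ = 0)).resolve_left hy0
    rw [characteristicFunction, ← hπ]
    ring
  · intro h
    obtain ⟨h1, h2, h3⟩ := phi_spec hσ μ
    exact ⟨_, _, h1, ⟨0, left_mem_Icc_pi, by rw [h2]; exact one_ne_zero⟩, h3, h⟩

/-- Integrating the Wronskian of φ(·, ν) and φ(·, μ) gives Δ(ν) φ(π, μ) = -(ν - μ) ∫ φ(x, ν) φ(x, μ)
dx, because Δ(μ) = 0. Divide by ν - μ and let ν tend to μ. -/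
theorem deriv_characteristicFunction_mul (hσ : MemLp σ 2 intervalMeasure) {H μ : ℂ}
    (hμ : characteristicFunction σ H μ = 0) :
    deriv (characteristicFunction σ H) μ * phi σ μ Real.pi =
      -∫ x in (0 : ℝ)..Real.pi, phi σ μ x ^ 2 := by
  -- `phi` is chosen separately for each μ and is determined only on [0, π]; the jointly continuous
  -- family replaces it under the integral.
  obtain ⟨y, z, h, hc, -⟩ := exists_isSolution_family hσ 1 0
  have heq : ∀ ν, ∀ x ∈ Set.Icc 0 Real.pi, phi σ ν x = y ν x := fun ν x hx => by
    obtain ⟨h1, h2, h3⟩ := phi_spec hσ ν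
    exact (h1.eqOn hσ (h ν).1 (h2.trans (h ν).2.1.symm) (h3.trans (h ν).2.2.symm) x hx).1
  have hq : Continuous fun ν => ∫ x in (0 : ℝ)..Real.pi, y ν x * y μ x := by
    refine intervalIntegral.continuous_parametric_intervalIntegral_of_continuous' ?_ _ _
    exact hc.mul (hc.comp (continuous_const.prodMk continuous_snd))
  have hid : ∀ ν, characteristicFunction σ H ν * phi σ μ Real.pi =
      -((ν - μ) * ∫ x in (0 : ℝ)..Real.pi, y ν x * y μ x) := by
    intro ν
    have hw := ((phi_spec hσ ν).1.wronskian (phi_spec hσ μ).1).integral_eq_sub Real.pi_pos.le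
    rw [intervalIntegral.integral_const_mul, (phi_spec hσ ν).2.2, (phi_spec hσ μ).2.2] at hw
    have e : ∫ x in (0 : ℝ)..Real.pi, phi σ ν x * phi σ μ x =
        ∫ x in (0 : ℝ)..Real.pi, y ν x * y μ x :=
      intervalIntegral.integral_congr fun x hx => by
        rw [Set.uIcc_of_le Real.pi_pos.le] at hx
        simp only [heq ν x hx, heq μ x hx]
    rw [e] at hw
    rw [hw]
    rw [characteristicFunction] at hμ ⊢
    linear_combination (phi σ ν Real.pi) * hμ
  have hd1 : HasDerivAt (fun ν => characteristicFunction σ H ν * phi σ μ Real.pi)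
      (deriv (characteristicFunction σ H) μ * phi σ μ Real.pi) μ :=
    (differentiable_characteristicFunction hσ H μ).hasDerivAt.mul_const _
  have hd2 : HasDerivAt (fun ν => characteristicFunction σ H ν * phi σ μ Real.pi)
      (-∫ x in (0 : ℝ)..Real.pi, y μ x * y μ x) μ := by
    simp only [hid]
    refine HasDerivAt.neg ?_
    rw [hasDerivAt_iff_tendsto_slope]
    refine (hq.continuousAt.tendsto.mono_left nhdsWithin_le_nhds).congr' ?_
    filter_upwards [self_mem_nhdsWithin] with ν hν
    have : ν - μ ≠ 0 := sub_ne_zero.2 hν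
    rw [slope_def_field]
    field_simp
    simp
  rw [hd1.unique hd2]
  congr 1
  refine intervalIntegral.integral_congr fun x hx => ?_
  rw [Set.uIcc_of_le Real.pi_pos.le] at hx
  simp only [heq μ x hx, pow_two]

theorem exists_eigenvalue_of_eq_zero (hσ : MemLp σ 2 intervalMeasure) {H μ : ℂ} {lam : ℕ → ℂ}
    (hlam : IsEigenvalueSequence σ H lam) (hsimple : ∀ n k, n ≠ k → lam n ≠ lam k)
    (hμ : characteristicFunction σ H μ = 0) :
    (∃ n, lam n = μ) ∧ analyticOrderAt (characteristicFunction σ H) μ = 1 := by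
  have hm := hlam.multiplicity μ ((isEigenvalue_iff hσ H μ).2 hμ)
  have hne : {n | lam n = μ}.encard ≠ 0 := by
    rw [hm]
    exact ((differentiable_characteristicFunction hσ H).analyticAt μ).analyticOrderAt_ne_zero.2 hμ
  have hsub : {n | lam n = μ}.Subsingleton := fun n hn k hk => by
    by_contra hnk
    exact hsimple n k hnk (Eq.trans hn (Eq.symm hk))
  obtain ⟨n, hn⟩ := Set.encard_ne_zero.1 hne
  refine ⟨⟨n, hn⟩, ?_⟩
  rw [← hm, hsub.eq_singleton_of_mem hn, Set.encard_singleton]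

/-- Δ(ρ²) is -ρ sin(ρπ) up to errors. The sine contributes 1/4, the asymptotic error and the H term
at most 1/16 each, which leaves 1/8. -/
theorem exists_lower_bound (hσ : MemLp σ 2 intervalMeasure) (H : ℂ) :
    ∃ R, ∀ ρ : ℂ, 0 ≤ ρ.im → R ≤ ‖ρ‖ →
      (Real.cos (ρ * Real.pi).re = 0 ∨ 1 / 2 ≤ (ρ * Real.pi).im) →
      ‖ρ‖ * Real.exp (ρ.im * Real.pi) ≤ 8 * ‖characteristicFunction σ H (ρ ^ 2)‖ ∧
        characteristicFunction σ H (ρ ^ 2) ≠ 0 := by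
  obtain ⟨R, hR1, hR⟩ := exists_asymptotics hσ (ε := 1 / 16) (by norm_num)
  obtain ⟨C, hC0, hC⟩ := exists_bound_solution hσ 1 0
  refine ⟨max R (16 * ‖H‖ * C), fun ρ him hρ hs => ?_⟩
  have hρR : R ≤ ‖ρ‖ := (le_max_left _ _).trans hρ
  have hρC : 16 * ‖H‖ * C ≤ ‖ρ‖ := (le_max_right _ _).trans hρ
  obtain ⟨h1, h2, h3⟩ := phi_spec hσ (ρ ^ 2)
  have hz := (hR ρ him hρR _ _ h1 h2 h3 _ right_mem_Icc_pi).2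
  have hy := hC ρ him (by linarith) _ _ h1 h2 h3 _ right_mem_Icc_pi
  have hsin := exp_le_norm_sin hs
  rw [Complex.im_mul_ofReal] at hsin
  have hE := Real.exp_pos (ρ.im * Real.pi)
  set E := Real.exp (ρ.im * Real.pi)
  have hkey : ‖ρ‖ * E ≤ 8 * ‖characteristicFunction σ H (ρ ^ 2)‖ := by
    have e1 : ρ * Complex.sin (ρ * Real.pi) =
        (phiQuasi σ (ρ ^ 2) Real.pi + ρ * Complex.sin (ρ * Real.pi)) +
        H * phi σ (ρ ^ 2) Real.pi - characteristicFunction σ H (ρ ^ 2) := by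
      rw [characteristicFunction]; ring
    have e2 : ‖ρ‖ * ‖Complex.sin (ρ * Real.pi)‖ ≤ 1 / 16 * ‖ρ‖ * E + ‖H‖ * (C * E) +
        ‖characteristicFunction σ H (ρ ^ 2)‖ := by
      rw [← norm_mul, e1]
      refine (norm_sub_le _ _).trans (add_le_add_left ((norm_add_le _ _).trans
        (add_le_add hz ?_)) _)
      rw [norm_mul]
      exact mul_le_mul_of_nonneg_left hy (norm_nonneg _)
    have e3 := mul_le_mul_of_nonneg_left hsin (norm_nonneg ρ)
    have e4 := mul_le_mul_of_nonneg_right hρC hE.le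
    nlinarith
  refine ⟨hkey, fun h0 => ?_⟩
  rw [h0, norm_zero, mul_zero] at hkey
  have : 0 < ‖ρ‖ * E := mul_pos (by linarith) hE
  linarith

theorem two_le_analyticOrderAt {N : ℂ → ℂ} {μ : ℂ} (hN : AnalyticAt ℂ N μ) (h0 : N μ = 0)
    (h1 : deriv N μ = 0) : 2 ≤ analyticOrderAt N μ := by
  refine (natCast_le_analyticOrderAt_iff_iteratedDeriv_eq_zero (n := 2) hN).2 fun i hi => ?_
  interval_cases i
  · simpa using h0
  · simpa using h1

/-! ### Two problems with the same spectral data -/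

section TwoProblems

variable {σ σ' : ℝ → ℂ} {H H' : ℂ} {lam lam' : ℕ → ℂ}

/-- The difference of the two sides is divided by Δ Δ'. It has at least double zeros where Δ Δ' has
exactly double ones, and the quotient decays like 1/|ρ| on the squares, so `eq_zero_of_quotient_le`
applies. -/
theorem right_mul_phi_mul_eq {f g f' g' : ℂ → ℝ → ℂ} {C C' : ℝ}
    (hσ : MemLp σ 2 intervalMeasure) (hσ' : MemLp σ' 2 intervalMeasure)
    (hlam : IsEigenvalueSequence σ H lam) (hlam' : IsEigenvalueSequence σ' H' lam')
    (hsimple : ∀ n k, n ≠ k → lam n ≠ lam k) (hsimple' : ∀ n k, n ≠ k → lam' n ≠ lam' k)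
    (heigenvalues : ∀ n, lam n = lam' n)
    (hweights : ∀ n, weightNumber σ (lam n) = weightNumber σ' (lam' n))
    (hf : IsRightFamily σ H f g C) (hf' : IsRightFamily σ' H' f' g' C')
    {x : ℝ} (hx : x ∈ Set.Icc 0 Real.pi) (μ : ℂ) :
    f μ x * phi σ' μ x * characteristicFunction σ' H' μ =
      phi σ μ x * f' μ x * characteristicFunction σ H μ := by
  have hΔ := differentiable_characteristicFunction hσ H
  have hΔ' := differentiable_characteristicFunction hσ' H'
  have hφ := (differentiable_phi hσ hx).1
  have hφ' := (differentiable_phi hσ' hx).1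
  have hψ := hf.differentiable x
  have hψ' := hf'.differentiable x
  have hN : Differentiable ℂ fun μ => f μ x * phi σ' μ x * characteristicFunction σ' H' μ -
      phi σ μ x * f' μ x * characteristicFunction σ H μ :=
    ((hψ.mul hφ').mul hΔ').sub ((hφ.mul hψ').mul hΔ)
  have hD : Differentiable ℂ fun μ =>
      characteristicFunction σ H μ * characteristicFunction σ' H' μ := hΔ.mul hΔ'
  obtain ⟨Q, hQ1, hQ⟩ := exists_bound_solution hσ 1 0
  obtain ⟨Q', hQ1', hQ'⟩ := exists_bound_solution hσ' 1 0
  obtain ⟨R, hR⟩ := exists_lower_bound hσ H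
  obtain ⟨R', hR'⟩ := exists_lower_bound hσ' H'
  refine sub_eq_zero.1 (eq_zero_of_quotient_le hN hD (fun μ => ?_) (C := 8 * (C * Q' + Q * C'))
    (R := max 1 (max R R')) (fun n ρ him hn hρ hb => ?_) μ)
  · by_cases hDμ : characteristicFunction σ H μ * characteristicFunction σ' H' μ = 0
    · have hboth : ∃ n, lam n = μ ∧ analyticOrderAt (characteristicFunction σ H) μ = 1 ∧
          analyticOrderAt (characteristicFunction σ' H') μ = 1 ∧
          characteristicFunction σ H μ = 0 ∧ characteristicFunction σ' H' μ = 0 := by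
        rcases mul_eq_zero.1 hDμ with h0 | h0
        · obtain ⟨⟨n, hn⟩, ho⟩ := exists_eigenvalue_of_eq_zero hσ hlam hsimple h0
          have h0' : characteristicFunction σ' H' μ = 0 := by
            rw [← hn, heigenvalues]
            exact (isEigenvalue_iff hσ' H' _).1 (hlam'.isEigenvalue n)
          exact ⟨n, hn, ho, (exists_eigenvalue_of_eq_zero hσ' hlam' hsimple' h0').2, h0, h0'⟩
        · obtain ⟨⟨n, hn⟩, ho⟩ := exists_eigenvalue_of_eq_zero hσ' hlam' hsimple' h0
          rw [← heigenvalues] at hn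
          have h0' : characteristicFunction σ H μ = 0 := by
            rw [← hn]
            exact (isEigenvalue_iff hσ H _).1 (hlam.isEigenvalue n)
          exact ⟨n, hn, (exists_eigenvalue_of_eq_zero hσ hlam hsimple h0').2, ho, h0', h0⟩
      obtain ⟨n, hn, ho, ho', h0, h0'⟩ := hboth
      have hoD : analyticOrderAt (fun μ =>
          characteristicFunction σ H μ * characteristicFunction σ' H' μ) μ = 2 := by
        have := analyticOrderAt_mul (hΔ.analyticAt μ) (hΔ'.analyticAt μ)
        rw [ho, ho'] at this
        exact this.trans (by norm_num)
      rw [hoD]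
      refine two_le_analyticOrderAt (hN.analyticAt μ) (by rw [h0, h0']; ring) ?_
      have hd := ((((hψ μ).hasDerivAt.mul (hφ' μ).hasDerivAt).mul (hΔ' μ).hasDerivAt).sub
        (((hφ μ).hasDerivAt.mul (hψ' μ).hasDerivAt).mul (hΔ μ).hasDerivAt)).deriv
      refine hd.trans ?_
      simp only [Pi.mul_apply, h0, h0', mul_zero, zero_add]
      have hw := hweights n
      rw [← heigenvalues, hn] at hw
      -- Inversion with 0⁻¹ = 0 is injective, so the integrals of φ² agree without checking that
      -- they are nonzero.
      have hint := inv_injective hw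
      have hd1 := deriv_characteristicFunction_mul hσ h0
      have hd2 := deriv_characteristicFunction_mul hσ' h0'
      have hp1 := hf.apply_mul_phi hσ h0 hx
      have hp2 := hf'.apply_mul_phi hσ' h0' hx
      have hne := mul_ne_zero (phi_pi_ne_zero hσ h0) (phi_pi_ne_zero hσ' h0')
      rw [hint, ← hd2] at hd1
      -- Multiplying by φ(π) φ'(π) ≠ 0 turns f and f' into φ and φ', and both derivatives of
      -- characteristic functions into the same integral.
      refine (mul_eq_zero.1 (?_ : (phi σ μ Real.pi * phi σ' μ Real.pi) * _ = 0)).resolve_left hne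
      rw [← hp1, ← hp2]
      linear_combination (-(phi σ μ Real.pi * phi σ' μ Real.pi * f μ x * f' μ x)) * hd1
    · rw [(hD.analyticAt μ).analyticOrderAt_eq_zero.2 hDμ]
      exact zero_le
  · have hn1 : (1 : ℝ) ≤ n := (le_max_left _ _).trans hn
    have hnR : R ≤ n := (le_max_left _ _).trans ((le_max_right _ _).trans hn)
    have hnR' : R' ≤ n := (le_max_right _ _).trans ((le_max_right _ _).trans hn)
    have hcond : Real.cos (ρ * Real.pi).re = 0 ∨ 1 / 2 ≤ (ρ * Real.pi).im := by
      rcases hb with hb | hb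
      · left
        rw [Complex.re_mul_ofReal, ← Real.cos_abs, abs_mul, hb, abs_of_pos Real.pi_pos,
          Real.cos_eq_zero_iff]
        exact ⟨n, by push_cast; ring⟩
      · right
        rw [Complex.im_mul_ofReal, hb]
        nlinarith [Real.pi_gt_three]
    obtain ⟨hl, hl0⟩ := hR ρ him (hnR.trans hρ) hcond
    obtain ⟨hl', hl0'⟩ := hR' ρ him (hnR'.trans hρ) hcond
    refine ⟨mul_ne_zero hl0 hl0', ?_⟩
    obtain ⟨h1, h2, h3⟩ := phi_spec hσ (ρ ^ 2)
    obtain ⟨h1', h2', h3'⟩ := phi_spec hσ' (ρ ^ 2)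
    have hφb := hQ ρ him (hn1.trans hρ) _ _ h1 h2 h3 x hx
    have hφb' := hQ' ρ him (hn1.trans hρ) _ _ h1' h2' h3' x hx
    have hψb := hf.bound ρ him (hn1.trans hρ) x hx
    have hψb' := hf'.bound ρ him (hn1.trans hρ) x hx
    have hexp : Real.exp (ρ.im * (Real.pi - x)) * Real.exp (ρ.im * x) =
        Real.exp (ρ.im * Real.pi) := by
      rw [← Real.exp_add]; ring_nf
    have hC0 := hf.nonneg
    have hC0' := hf'.nonneg
    have e1 : ‖f (ρ ^ 2) x‖ * ‖phi σ' (ρ ^ 2) x‖ ≤ C * Q' * Real.exp (ρ.im * Real.pi) := by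
      rw [← hexp]
      calc _ ≤ (C * Real.exp (ρ.im * (Real.pi - x))) * (Q' * Real.exp (ρ.im * x)) :=
            mul_le_mul hψb hφb' (norm_nonneg _) (by positivity)
        _ = _ := by ring
    have e2 : ‖phi σ (ρ ^ 2) x‖ * ‖f' (ρ ^ 2) x‖ ≤ Q * C' * Real.exp (ρ.im * Real.pi) := by
      rw [← hexp]
      calc _ ≤ (Q * Real.exp (ρ.im * x)) * (C' * Real.exp (ρ.im * (Real.pi - x))) :=
            mul_le_mul hφb hψb' (norm_nonneg _) (by positivity)
        _ = _ := by ring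
    rw [norm_mul]
    set d := ‖characteristicFunction σ H (ρ ^ 2)‖
    set d' := ‖characteristicFunction σ' H' (ρ ^ 2)‖
    set e := Real.exp (ρ.im * Real.pi)
    have hd0 : 0 ≤ d := norm_nonneg _
    have hd0' : 0 ≤ d' := norm_nonneg _
    calc _ ≤ (‖f (ρ ^ 2) x‖ * ‖phi σ' (ρ ^ 2) x‖ * d' +
          ‖phi σ (ρ ^ 2) x‖ * ‖f' (ρ ^ 2) x‖ * d) * ‖ρ‖ := by
          refine mul_le_mul_of_nonneg_right ((norm_sub_le _ _).trans ?_) (norm_nonneg _)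
          rw [norm_mul, norm_mul, norm_mul, norm_mul]
      _ ≤ (C * Q' * e * d' + Q * C' * e * d) * ‖ρ‖ := by gcongr
      _ = C * Q' * d' * (‖ρ‖ * e) + Q * C' * d * (‖ρ‖ * e) := by ring
      _ ≤ C * Q' * d' * (8 * d) + Q * C' * d * (8 * d') := by gcongr
      _ = _ := by ring

/-- For ρ = it the leading term is cosh(tx) ≥ exp(tx)/2, which exceeds the error exp(tx)/4. -/
theorem exists_phi_ne_zero (hσ : MemLp σ 2 intervalMeasure) :
    ∃ R : ℝ, ∀ t : ℝ, R ≤ t → ∀ x ∈ Set.Icc 0 Real.pi, phi σ ((Complex.I * t) ^ 2) x ≠ 0 := by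
  obtain ⟨R, hR1, hR⟩ := exists_asymptotics hσ (ε := 1 / 4) (by norm_num)
  refine ⟨R, fun t ht x hx h0 => ?_⟩
  have ht0 : 0 ≤ t := by linarith
  have him : (Complex.I * (t : ℂ)).im = t := by simp
  have hno : ‖Complex.I * (t : ℂ)‖ = t := by
    rw [norm_mul, Complex.norm_I, one_mul, Complex.norm_real, Real.norm_of_nonneg ht0]
  obtain ⟨h1, h2, h3⟩ := phi_spec hσ ((Complex.I * t) ^ 2)
  have h := (hR (Complex.I * t) (by rw [him]; exact ht0) (by rw [hno]; exact ht) _ _ h1 h2 h3 x hx).1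
  have hcos : Complex.cos (Complex.I * t * x) = (Real.cosh (t * x) : ℂ) := by
    rw [mul_assoc, mul_comm, Complex.cos_mul_I]
    push_cast
    rfl
  rw [h0, hcos, zero_sub, norm_neg, Complex.norm_real, Real.norm_of_nonneg (Real.cosh_pos _).le,
    him, Real.cosh_eq] at h
  have := Real.exp_pos (t * x)
  have := Real.exp_pos (-(t * x))
  linarith

/-- If `f φ' = f' φ` for functions with the same Wronskian relations, then `φ² = φ'²`. -/
theorem sq_eq_sq_of_wronskian {u v u' v' z w z' w' s s' : ℂ}
    (h : u * v' = u' * v)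
    (hd : (s * u + w) * v' + u * (s' * v' + z') = (s' * u' + w') * v + u' * (s * v + z))
    (hw : v * w - u * z = -1) (hw' : v' * w' - u' * z' = -1) : v ^ 2 = v' ^ 2 := by
  -- By `h` the terms with s and s' cancel in `hd`; multiplying the rest by v v' brings in the two
  -- Wronskians, and `h` removes what is left of u and u'.
  linear_combination (v * v') * hd - v' ^ 2 * hw + v ^ 2 * hw' -
    ((s + s') * v * v' + z * v' + z' * v) * h

end TwoProblems

end SturmLiouville

/-! ### Recovering σ and H -/

namespace SturmLiouville

variable {σ σ' : ℝ → ℂ} {H H' : ℂ} {lam lam' : ℕ → ℂ}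

theorem ae_iff_intervalMeasure {p : ℝ → Prop} :
    (∀ᵐ x ∂intervalMeasure, p x) ↔ ∀ᵐ x, x ∈ Set.Ioo 0 Real.pi → p x :=
  ae_restrict_iff' measurableSet_Ioo

/-- At a spectral parameter where the solutions `φ` do not vanish and are related as in
`right_mul_phi_mul_eq`, the two solutions coincide. -/
theorem phi_eq_phi {f g f' g' : ℂ → ℝ → ℂ} {C C' : ℝ}
    (hσ : MemLp σ 2 intervalMeasure) (hσ' : MemLp σ' 2 intervalMeasure)
    (hf : IsRightFamily σ H f g C) (hf' : IsRightFamily σ' H' f' g' C') {μ : ℂ}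
    (hΔ : characteristicFunction σ H μ ≠ 0) (hΔ' : characteristicFunction σ' H' μ ≠ 0)
    (hφ' : ∀ x ∈ Set.Icc 0 Real.pi, phi σ' μ x ≠ 0)
    (h : ∀ x ∈ Set.Icc 0 Real.pi, f μ x * phi σ' μ x * characteristicFunction σ' H' μ =
      phi σ μ x * f' μ x * characteristicFunction σ H μ) :
    ∀ x ∈ Set.Icc 0 Real.pi, phi σ μ x = phi σ' μ x := by
  obtain ⟨h1, h2, -⟩ := phi_spec hσ μ
  obtain ⟨h1', h2', -⟩ := phi_spec hσ' μ
  set Δ := characteristicFunction σ H μ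
  set Δ' := characteristicFunction σ' H' μ
  have hc := h1.isPrimitiveOn.continuousOn Real.pi_pos.le
  have hc' := h1'.isPrimitiveOn.continuousOn Real.pi_pos.le
  have hrel : ∀ x ∈ Set.Icc 0 Real.pi, f μ x / Δ * phi σ' μ x = f' μ x / Δ' * phi σ μ x := by
    intro x hx
    have := h x hx
    field_simp
    linear_combination this
  have hsqae : ∀ᵐ x, x ∈ Set.Ioo 0 Real.pi → phi σ μ x ^ 2 = phi σ' μ x ^ 2 := by
    filter_upwards [h1.isPrimitiveOn.ae_hasDerivAt, h1'.isPrimitiveOn.ae_hasDerivAt,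
      (hf.isSolution μ).isPrimitiveOn.ae_hasDerivAt,
      (hf'.isSolution μ).isPrimitiveOn.ae_hasDerivAt] with x d1 d1' d2 d2' hx
    have hx' := Set.Ioo_subset_Icc_self hx
    have hw := hf.wronskian_phi hσ μ hx'
    have hw' := hf'.wronskian_phi hσ' μ hx'
    have e1 := ((d2 hx).div_const Δ).mul (d1' hx)
    have e2 := ((d2' hx).div_const Δ').mul (d1 hx)
    have e3 : (fun x => f μ x / Δ * phi σ' μ x) =ᶠ[nhds x]
        fun x => f' μ x / Δ' * phi σ μ x := by
      filter_upwards [Ioo_mem_nhds hx.1 hx.2] with t ht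
      exact hrel t (Set.Ioo_subset_Icc_self ht)
    have hd := (e1.congr_of_eventuallyEq e3.symm).unique e2
    refine sq_eq_sq_of_wronskian (u := f μ x / Δ) (u' := f' μ x / Δ') (z := phiQuasi σ μ x)
      (z' := phiQuasi σ' μ x) (w := g μ x / Δ) (w' := g' μ x / Δ') (s := σ x) (s' := σ' x)
      (hrel x hx') ?_ ?_ ?_
    · linear_combination hd
    · change _ = -Δ at hw
      field_simp
      linear_combination hw
    · change _ = -Δ' at hw'
      field_simp
      linear_combination hw'
  have hsq : Set.EqOn (phi σ μ ^ 2) (phi σ' μ ^ 2) (Set.Icc 0 Real.pi) := by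
    have hIoo : Set.EqOn (fun x => phi σ μ x ^ 2) (fun x => phi σ' μ x ^ 2) (Set.Ioo 0 Real.pi) := by
      refine Measure.eqOn_open_of_ae_eq (μ := volume)
        ((ae_restrict_iff' measurableSet_Ioo).2 hsqae) isOpen_Ioo ?_ ?_
      · exact (hc.pow 2).mono Set.Ioo_subset_Icc_self
      · exact (hc'.pow 2).mono Set.Ioo_subset_Icc_self
    exact hIoo.of_subset_closure (hc.pow 2) (hc'.pow 2) Set.Ioo_subset_Icc_self
      (closure_Ioo Real.pi_pos.ne).symm.subset
  -- On a connected set, continuous square roots of the same function without zeros agree as soon as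
  -- they agree at one point, here 0.
  exact isPreconnected_Icc.eq_of_sq_eq hc hc' hsq (fun {x} hx => hφ' x hx) left_mem_Icc_pi
    (h2.trans h2'.symm)

/-- Comparing y' = σ y + y^[1] for the common φ gives (σ - σ') φ = G, the difference of the
quasi-derivatives. The second equation becomes G' = (φ_x/φ) G, where φ_x is the x-derivative of φ,
with G(0) = 0. The factor φ_x/φ is integrable because φ has no zeros, so Gronwall's inequality gives
G = 0. -/
theorem ae_eq_of_phi_eq (hσ : MemLp σ 2 intervalMeasure) (hσ' : MemLp σ' 2 intervalMeasure) {μ : ℂ}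
    (hφ : ∀ x ∈ Set.Icc 0 Real.pi, phi σ μ x ≠ 0)
    (heq : ∀ x ∈ Set.Icc 0 Real.pi, phi σ μ x = phi σ' μ x) : σ =ᵐ[intervalMeasure] σ' := by
  obtain ⟨h1, -, h3⟩ := phi_spec hσ μ
  obtain ⟨h1', -, h3'⟩ := phi_spec hσ' μ
  have hπ := Real.pi_pos.le
  have hc := h1.isPrimitiveOn.continuousOn hπ
  have hdiff : ∀ᵐ x, x ∈ Set.Ioo 0 Real.pi →
      (σ x - σ' x) * phi σ μ x = phiQuasi σ' μ x - phiQuasi σ μ x := by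
    filter_upwards [h1.isPrimitiveOn.ae_hasDerivAt, h1'.isPrimitiveOn.ae_hasDerivAt] with x d d' hx
    have e : phi σ μ =ᶠ[nhds x] phi σ' μ := by
      filter_upwards [Ioo_mem_nhds hx.1 hx.2] with t ht
      exact heq t (Set.Ioo_subset_Icc_self ht)
    have hd := ((d hx).congr_of_eventuallyEq e.symm).unique (d' hx)
    rw [← heq x (Set.Ioo_subset_Icc_self hx)] at hd
    linear_combination hd
  have hg := h1'.isPrimitiveOn_quasi.sub hπ h1.isPrimitiveOn_quasi
  set G : ℝ → ℂ := fun x => phiQuasi σ' μ x - phiQuasi σ μ x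
  have hGc := hg.continuousOn hπ
  set k : ℝ → ℂ := fun x => (σ x * phi σ μ x + phiQuasi σ μ x) * (phi σ μ x)⁻¹
  have hk : IntervalIntegrable k volume 0 Real.pi :=
    h1.isPrimitiveOn.integrable.mul_continuousOn
      (by rw [Set.uIcc_of_le hπ]; exact hc.inv₀ hφ)
  have hder : ∀ᵐ x, x ∈ Set.Ioo 0 Real.pi → -(σ' x * phiQuasi σ' μ x) - σ' x ^ 2 * phi σ' μ x -
      μ * phi σ' μ x - (-(σ x * phiQuasi σ μ x) - σ x ^ 2 * phi σ μ x - μ * phi σ μ x) =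
      k x * G x := by
    filter_upwards [hdiff] with x hx hx'
    have h := hx hx'
    have hne := hφ x (Set.Ioo_subset_Icc_self hx')
    rw [← heq x (Set.Ioo_subset_Icc_self hx')]
    simp only [k, G]
    rw [← h]
    field_simp
    linear_combination σ' x * h
  have hgr := gronwall (k := fun t => ‖k t‖) (f := fun x => ‖G x‖) (a := 0) hπ hk.norm
    (fun t => norm_nonneg _) hGc.norm le_rfl ?_
  · have hG0 : ∀ x ∈ Set.Icc 0 Real.pi, G x = 0 := fun x hx => by
      have := hgr x hx
      rw [mul_zero, zero_mul] at this
      exact norm_le_zero_iff.1 this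
    refine ae_iff_intervalMeasure.2 ?_
    filter_upwards [hdiff] with x hx hx'
    have h := hx hx'
    have hx'' := Set.Ioo_subset_Icc_self hx'
    have h0 := hG0 x hx''
    simp only [G] at h0
    rw [h0] at h
    exact sub_eq_zero.1 ((mul_eq_zero.1 h).resolve_right (hφ x hx''))
  · intro x hx
    have hG00 : G 0 = 0 := by simp [G, h3, h3']
    rw [zero_add, hg.eq x hx]
    change ‖G 0 + _‖ ≤ _
    rw [hG00, zero_add]
    have hsub : Set.uIcc 0 x ⊆ Set.uIcc 0 Real.pi := by
      rw [Set.uIcc_of_le hx.1, Set.uIcc_of_le hπ]; exact Set.Icc_subset_Icc_right hx.2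
    refine intervalIntegral.norm_integral_le_of_norm_le hx.1 ?_
      ((hk.mono_set hsub).norm.mul_continuousOn
        (hGc.norm.mono (by rwa [Set.uIcc_of_le hπ] at hsub)))
    have hneπ : ∀ᵐ t : ℝ, t ≠ Real.pi := by simp [ae_iff]
    filter_upwards [hder, hneπ] with t ht htπ ht'
    rw [ht ⟨ht'.1, lt_of_le_of_ne (ht'.2.trans hx.2) htπ⟩, norm_mul]

end SturmLiouville

theorem mainTheorem3
    (σ σ' : ℝ → ℂ)
    (hσ : MemLp σ 2 SturmLiouville.intervalMeasure)
    (hσ' : MemLp σ' 2 SturmLiouville.intervalMeasure)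
    (H H' : ℂ) (lam lam' : ℕ → ℂ)
    (hlam : SturmLiouville.IsEigenvalueSequence σ H lam)
    (hlam' : SturmLiouville.IsEigenvalueSequence σ' H' lam')
    (hsimple : ∀ n k, n ≠ k → lam n ≠ lam k)
    (hsimple' : ∀ n k, n ≠ k → lam' n ≠ lam' k)
    (heigenvalues : ∀ n, lam n = lam' n)
    (hweights : ∀ n,
      SturmLiouville.weightNumber σ (lam n) = SturmLiouville.weightNumber σ' (lam' n)) :
    σ =ᵐ[SturmLiouville.intervalMeasure] σ' ∧ H = H' := by
  open SturmLiouville in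
  obtain ⟨f, g, C, hf⟩ := exists_isRightFamily hσ H
  obtain ⟨f', g', C', hf'⟩ := exists_isRightFamily hσ' H'
  obtain ⟨R₁, hR₁⟩ := exists_phi_ne_zero hσ
  obtain ⟨R₂, hR₂⟩ := exists_phi_ne_zero hσ'
  obtain ⟨R₃, hR₃⟩ := exists_lower_bound hσ H
  obtain ⟨R₄, hR₄⟩ := exists_lower_bound hσ' H'
  -- One spectral parameter (it)² = -t² has to avoid the zeros of Δ and Δ' and make φ and φ'
  -- zero-free on [0, π].
  obtain ⟨t, ht⟩ : ∃ t, t = max 1 (max (max R₁ R₂) (max R₃ R₄)) := ⟨_, rfl⟩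
  have ht1 : 1 ≤ t := ht ▸ le_max_left _ _
  have htR : max (max R₁ R₂) (max R₃ R₄) ≤ t := ht ▸ le_max_right _ _
  simp only [max_le_iff] at htR
  obtain ⟨⟨ht₁, ht₂⟩, ht₃, ht₄⟩ := htR
  have him : (Complex.I * (t : ℂ)).im = t := by simp
  have hno : ‖Complex.I * (t : ℂ)‖ = t := by
    rw [norm_mul, Complex.norm_I, one_mul, Complex.norm_real, Real.norm_of_nonneg (by linarith)]
  have hcond : Real.cos (Complex.I * t * Real.pi).re = 0 ∨
      1 / 2 ≤ (Complex.I * t * Real.pi).im := by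
    right
    rw [Complex.im_mul_ofReal, him]
    nlinarith [Real.pi_gt_three]
  have heq := phi_eq_phi hσ hσ' hf hf'
    (hR₃ _ (by rw [him]; linarith) (by rwa [hno]) hcond).2
    (hR₄ _ (by rw [him]; linarith) (by rwa [hno]) hcond).2 (hR₂ t ht₂) fun x hx =>
    right_mul_phi_mul_eq hσ hσ' hlam hlam' hsimple hsimple' heigenvalues hweights hf hf' hx _
  have hσσ' := ae_eq_of_phi_eq hσ hσ' (hR₁ t ht₁) heq
  refine ⟨hσσ', ?_⟩
  -- With σ = σ' the functions φ agree at λ₀, so both boundary conditions at π hold for the same φ,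
  -- and φ(π, λ₀) ≠ 0.
  have h0 := (isEigenvalue_iff hσ H _).1 (hlam.isEigenvalue 0)
  have h0' := (isEigenvalue_iff hσ' H' _).1 (hlam'.isEigenvalue 0)
  rw [← heigenvalues] at h0'
  obtain ⟨h1, h2, h3⟩ := phi_spec hσ (lam 0)
  obtain ⟨h1', h2', h3'⟩ := phi_spec hσ' (lam 0)
  obtain ⟨e1, e2⟩ := (h1.congr_ae hσσ').eqOn hσ' h1' (h2.trans h2'.symm) (h3.trans h3'.symm) _
    right_mem_Icc_pi
  have hne := phi_pi_ne_zero hσ h0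
  rw [characteristicFunction] at h0 h0'
  rw [← e1, ← e2] at h0'
  exact mul_right_cancel₀ hne (by linear_combination h0 - h0')
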